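/- Let $M$ be a connected, closed (compact, without boundary), smooth Riemannian manifold of dimension $n$ with Riemannian distance $d$, and let $|p|$ denote the norm on $T_x^*M$ dual to the Riemannian norm on $T_xM$. Let $H=H(x,p,u):T^*M\times\mathbb R\to\mathbb R$ satisfy: (H1) $H$ is continuous on $T^*M\times\mathbb R$; (H2) for every $R>0$ there is $K>0$ such that $H(x,p,u)>R$ whenever $|u|\le R$ and $|p|\ge K$; (H3) for all $(x,u)\in M\times\mathbb R$, the function $p\mapsto H(x,p,u)$ is convex on $T^*_xM$; (H4) there is $\Lambda>0$ with $|H(x,p,u)-H(x,p,v)|\le\Lambda|u-v|$ for all $(x,p)\in T^*M$ and $u,v\in\mathbb R$. A lower semicontinuous function $u:M\times(0,\infty)\to\mathbb R\cup\{+\infty\}$ is called a BJ (Barron–Jensen) subsolution, respectively supersolution, of $u_t+H(x,D_xu,u)=0$ in $M\times(0,\infty)$ if, whenever $\phi\in C^1(M\times(0,\infty),\mathbb R)$ and $u-\phi$ attains a minimum over $M\times(0,\infty)$ at a point $(x,t)$ with $u(x,t)<\infty$, one has $\phi_t(x,t)+H(x,D_x\phi(x,t),u(x,t))\le 0$, respectively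 $\ge 0$. It is a BJ solution if it is both. Likewise, a lower semicontinuous function $v:M\to\mathbb R\cup\{+\infty\}$ is a BJ solution of $H(x,Dv,v)=0$ in $M$ if, whenever $\phi\in C^1(M,\mathbb R)$ and $v-\phi$ attains a minimum over $M$ at a point $x$ with $v(x)<\infty$, one has $H(x,D\phi(x),v(x))=0$. **Theorem 6.1.** Let $u$ be a BJ solution of $u_t+H(x,D_xu,u)=0$ in $M\times(0,\infty)$, and set $$v(x)=\lim_{r\to0+}\inf\{u(y,t)\mid d(y,x)<r,\ t>r^{-1}\}\in[-\infty,+\infty]\qquad(x\in M).$$ If $v(z)\in\mathbb R$ for some $z\in M$, then $v$ is real-valued and Lipschitz continuous on $M$ with respect to $d$, and $v$ is a viscosity solution of $H(x,Dv,v)=0$ in $M$ in the Crandall–Lions sense: for every $\phi\in C^1(M,\mathbb R)$, $H(x,D\phi(x),v(x))\le0$ at each maximum point $x$ of $v-\phi$, and $H(x,D\phi(x),v(x))\ge0$ at each minimum point $x$ of $v-\phi$. **Corollary 6.2.** Let $v$ be a BJ solution of $H(x,Dv,v)=0$ in $M$. If $v(z)\in\mathbb R$ for some $z\in M$, then $v$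 is real-valued and Lipschitz continuous on $M$. -/

import Mathlib

open Set Filter Topology Manifold Bundle
open scoped ContDiff NNReal

/-- The cotangent bundle `T*M` of an `n`-dimensional manifold, with Mathlib's topology of the bundle
of continuous linear maps from the tangent bundle to the trivial real line bundle. A covector at `x`
is written `⟨x, p⟩`, with `p : TangentSpace (𝓡 n) x →L[ℝ] ℝ`. -/
abbrev CotangentBundle (n : ℕ) (M : Type*) [TopologicalSpace M]
    [ChartedSpace (EuclideanSpace ℝ (Fin n)) M] : Type _ :=
  TotalSpace (EuclideanSpace ℝ (Fin n) →L[ℝ] ℝ)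
    (fun x : M => TangentSpace (𝓡 n) x →L[ℝ] Bundle.Trivial M ℝ x)

section Hamiltonian

variable {n : ℕ} {M : Type*} [TopologicalSpace M] [ChartedSpace (EuclideanSpace ℝ (Fin n)) M]

/-- Coercivity: for every `R > 0` there is `K > 0` with `H (x, p, u) > R` whenever `|u| ≤ R` and
`|p| ≥ K`, where `|p|` is the norm on the cotangent space dual to the Riemannian norm. -/
def IsCoerciveHamiltonian [RiemannianBundle (fun x : M => TangentSpace (𝓡 n) x)]
    (H : CotangentBundle n M → ℝ → ℝ) : Prop :=
  ∀ R : ℝ, 0 < R → ∃ K : ℝ, 0 < K ∧ ∀ (x : M) (p : TangentSpace (𝓡 n) x →L[ℝ] ℝ) (u : ℝ),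
    |u| ≤ R → K ≤ ‖p‖ → R < H ⟨x, p⟩ u

/-- Convexity of `p ↦ H (x, p, u)` on every cotangent space. -/
def IsConvexHamiltonian (H : CotangentBundle n M → ℝ → ℝ) : Prop :=
  ∀ (x : M) (u : ℝ), ConvexOn ℝ univ (fun p : TangentSpace (𝓡 n) x →L[ℝ] ℝ => H ⟨x, p⟩ u)

/-- The functions `u ↦ H (x, p, u)` are Lipschitz with a constant independent of `(x, p)`. -/
def IsEquiLipschitzHamiltonian (H : CotangentBundle n M → ℝ → ℝ) : Prop :=
  ∃ Λ : ℝ, 0 < Λ ∧ ∀ (q : CotangentBundle n M) (u v : ℝ), |H q u - H q v| ≤ Λ * |u - v|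

/-- The differential `Dφ(x)` of `φ : M → ℝ`, as a covector at `x`. -/
noncomputable def covectorD (φ : M → ℝ) (x : M) : TangentSpace (𝓡 n) x →L[ℝ] ℝ :=
  mfderiv (𝓡 n) 𝓘(ℝ, ℝ) φ x

/-! ### The evolution equation on `M × (0, ∞)` -/

/-- The space-time domain `M × (0, ∞)`. -/
def spaceTime (M : Type*) : Set (M × ℝ) := univ ×ˢ Ioi 0

/-- `φ` is a `C¹` function on `M × (0, ∞)` (its values elsewhere are irrelevant). -/
def IsC1SpaceTime (n : ℕ) {M : Type*} [TopologicalSpace M]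
    [ChartedSpace (EuclideanSpace ℝ (Fin n)) M] (φ : M × ℝ → ℝ) : Prop :=
  ContMDiffOn ((𝓡 n).prod 𝓘(ℝ, ℝ)) 𝓘(ℝ, ℝ) 1 φ (spaceTime M)

/-- `φ_t(x,t) + H(x, D_xφ(x,t), r)`. -/
noncomputable def evolutionExpr (H : CotangentBundle n M → ℝ → ℝ) (φ : M × ℝ → ℝ) (z : M × ℝ)
    (r : ℝ) : ℝ :=
  deriv (fun s => φ (z.1, s)) z.2 + H ⟨z.1, covectorD (fun y => φ (y, z.2)) z.1⟩ r

/-- `u ∈ LSC(M × (0, ∞), ℝ ∪ {∞})` is a lower semicontinuous viscosity (Barron–Jensen) subsolution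
of `u_t + H(x, D_x u, u) = 0` in `M × (0, ∞)`. The condition is imposed at points where `u - φ`
attains a finite minimum. -/
structure IsBJSubsolutionEvolution (H : CotangentBundle n M → ℝ → ℝ) (u : M × ℝ → EReal) :
    Prop where
  ne_bot : ∀ z ∈ spaceTime M, u z ≠ ⊥
  lsc : LowerSemicontinuousOn u (spaceTime M)
  test : ∀ φ : M × ℝ → ℝ, IsC1SpaceTime n φ → ∀ z ∈ spaceTime M, u z ≠ ⊤ →
    IsMinOn (fun w => u w - (φ w : EReal)) (spaceTime M) z → evolutionExpr H φ z (u z).toReal ≤ 0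

/-- Barron–Jensen supersolutions of `u_t + H(x, D_x u, u) = 0` in `M × (0, ∞)`. -/
structure IsBJSupersolutionEvolution (H : CotangentBundle n M → ℝ → ℝ) (u : M × ℝ → EReal) :
    Prop where
  ne_bot : ∀ z ∈ spaceTime M, u z ≠ ⊥
  lsc : LowerSemicontinuousOn u (spaceTime M)
  test : ∀ φ : M × ℝ → ℝ, IsC1SpaceTime n φ → ∀ z ∈ spaceTime M, u z ≠ ⊤ →
    IsMinOn (fun w => u w - (φ w : EReal)) (spaceTime M) z → 0 ≤ evolutionExpr H φ z (u z).toReal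

/-- Barron–Jensen solutions of `u_t + H(x, D_x u, u) = 0` in `M × (0, ∞)`. -/
def IsBJSolutionEvolution (H : CotangentBundle n M → ℝ → ℝ) (u : M × ℝ → EReal) : Prop :=
  IsBJSubsolutionEvolution H u ∧ IsBJSupersolutionEvolution H u

/-! ### The stationary equation on `M` -/

/-- `H(x, Dφ(x), r)`. -/
noncomputable def stationaryExpr (H : CotangentBundle n M → ℝ → ℝ) (φ : M → ℝ) (x : M) (r : ℝ) :
    ℝ :=
  H ⟨x, covectorD φ x⟩ r

/-- Barron–Jensen subsolutions `v ∈ LSC(M, ℝ ∪ {∞})` of `H(x, Dv, v) = 0` in `M`. -/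
structure IsBJSubsolutionStationary (H : CotangentBundle n M → ℝ → ℝ) (v : M → EReal) :
    Prop where
  ne_bot : ∀ x, v x ≠ ⊥
  lsc : LowerSemicontinuous v
  test : ∀ φ : M → ℝ, ContMDiff (𝓡 n) 𝓘(ℝ, ℝ) 1 φ → ∀ x, v x ≠ ⊤ →
    IsMinOn (fun y => v y - (φ y : EReal)) univ x → stationaryExpr H φ x (v x).toReal ≤ 0

/-- Barron–Jensen supersolutions `v ∈ LSC(M, ℝ ∪ {∞})` of `H(x, Dv, v) = 0` in `M`. -/
structure IsBJSupersolutionStationary (H : CotangentBundle n M → ℝ → ℝ) (v : M → EReal) :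
    Prop where
  ne_bot : ∀ x, v x ≠ ⊥
  lsc : LowerSemicontinuous v
  test : ∀ φ : M → ℝ, ContMDiff (𝓡 n) 𝓘(ℝ, ℝ) 1 φ → ∀ x, v x ≠ ⊤ →
    IsMinOn (fun y => v y - (φ y : EReal)) univ x → 0 ≤ stationaryExpr H φ x (v x).toReal

/-- Barron–Jensen solutions of `H(x, Dv, v) = 0` in `M`. -/
def IsBJSolutionStationary (H : CotangentBundle n M → ℝ → ℝ) (v : M → EReal) : Prop :=
  IsBJSubsolutionStationary H v ∧ IsBJSupersolutionStationary H v

/-- (Crandall–Lions) viscosity subsolutions of `H(x, Dw, w) = 0` in `M`: maxima of `w - φ`. -/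
structure IsViscositySubsolution (H : CotangentBundle n M → ℝ → ℝ) (w : M → ℝ) : Prop where
  usc : UpperSemicontinuous w
  test : ∀ φ : M → ℝ, ContMDiff (𝓡 n) 𝓘(ℝ, ℝ) 1 φ → ∀ x,
    IsMaxOn (fun y => w y - φ y) univ x → stationaryExpr H φ x (w x) ≤ 0

/-- (Crandall–Lions) viscosity supersolutions of `H(x, Dw, w) = 0` in `M`: minima of `w - φ`. -/
structure IsViscositySupersolution (H : CotangentBundle n M → ℝ → ℝ) (w : M → ℝ) : Prop where
  lsc : LowerSemicontinuous w
  test : ∀ φ : M → ℝ, ContMDiff (𝓡 n) 𝓘(ℝ, ℝ) 1 φ → ∀ x,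
    IsMinOn (fun y => w y - φ y) univ x → 0 ≤ stationaryExpr H φ x (w x)

/-- (Crandall–Lions) viscosity solutions of `H(x, Dw, w) = 0` in `M`. -/
def IsViscositySolution (H : CotangentBundle n M → ℝ → ℝ) (w : M → ℝ) : Prop :=
  IsViscositySubsolution H w ∧ IsViscositySupersolution H w

end Hamiltonian

/-! ### The lower relaxed limit as `t → ∞` -/

section LowerRelaxedLimit

variable {M : Type*} [PseudoMetricSpace M]

/-- `inf {u(y,t) | d(y,x) < r, t > r⁻¹}`, in the extended reals. -/
noncomputable def infNear (u : M × ℝ → EReal) (x : M) (r : ℝ) : EReal :=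
  sInf {a | ∃ (y : M) (t : ℝ), dist y x < r ∧ r⁻¹ < t ∧ a = u (y, t)}

/-- The lower relaxed limit `lim_{r → 0+} inf {u(y,t) | d(y,x) < r, t > r⁻¹}`; the limit exists
because the infimum is monotone in `r`, see `tendsto_lowerRelaxedLimit`. -/
noncomputable def lowerRelaxedLimit (u : M × ℝ → EReal) (x : M) : EReal :=
  limUnder (𝓝[>] (0 : ℝ)) (infNear u x)

theorem tendsto_lowerRelaxedLimit (u : M × ℝ → EReal) (x : M) :
    Tendsto (infNear u x) (𝓝[>] (0 : ℝ)) (𝓝 (lowerRelaxedLimit u x)) := by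
  have hanti : AntitoneOn (infNear u x) (Ioi 0) := by
    intro r hr s _ hrs
    refine sInf_le_sInf ?_
    rintro a ⟨y, t, hy, ht, rfl⟩
    exact ⟨y, t, hy.trans_le hrs, (inv_anti₀ hr hrs).trans_lt ht, rfl⟩
  exact tendsto_nhds_limUnder
    ⟨_, hanti.tendsto_nhdsGT (OrderTop.bddAbove _)⟩

end LowerRelaxedLimit

/-! The engine is finite-speed propagation of upper bounds. Convexity and coercivity make `H` grow
at least linearly in the covector, so in a chart a solution satisfies u_t + a|D_x u| ≤ C(1 + |u|)
for test functions touching from below. Writing u = sinh f turns this into f_t + a|D_x f| ≤ 2C, and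
a one-sided mean value inequality for lower semicontinuous functions (`le_add_mul_of_touching`)
bounds the growth of f along segments of speed at most a (`IsTouchingSolution.le_sinh`). As time
tends to infinity this leaves arsinh v(x) ≤ arsinh v(y) + K d(x, y) for x, y in a common small
neighbourhood. Finiteness therefore spreads by connectedness, and compactness makes v globally
Lipschitz.

That v solves the stationary equation for tests from below follows by touching u near v at large
times (`IsTouchingSolution.stationary`); this contains the supersolution half. For the subsolution
half, a covector outside the closed convex set {H ≤ 0} is separated from it by a direction e. The
mean value inequality bounds the growth of v along e, which no test function from above with that
covector can respect (`IsTouchingSolutionStationary.le_zero_of_touching_above`).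

The corollary is the time-independent case: a lower semicontinuous function is its own relaxed
limit. -/

/-- If `f` is lower semicontinuous on a compact set `K` and `f - θ` is larger off `O` than at some
point of `K`, then some translate `θ + m` touches `f` from below on `K` at a point of `O`. -/
theorem LowerSemicontinuousOn.exists_touching {X : Type*} [TopologicalSpace X] {K O : Set X}
    (hK : IsCompact K) {f : X → EReal} (hf : LowerSemicontinuousOn f K)
    (hbot : ∀ P ∈ K, f P ≠ ⊥) {θ : X → ℝ} (hθ : ContinuousOn θ K) {P₀ : X} (h₀ : P₀ ∈ K) {a : ℝ}
    (ha : f P₀ = a) (hO : ∀ P ∈ K, P ∉ O → ((θ P + (a - θ P₀) : ℝ) : EReal) < f P) :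
    ∃ P ∈ K, P ∈ O ∧ ∃ m : ℝ, m ≤ a - θ P₀ ∧ f P = ((θ P + m : ℝ) : EReal) ∧
      ∀ Q ∈ K, ((θ Q + m : ℝ) : EReal) ≤ f Q := by
  have hg : LowerSemicontinuousOn (fun P => f P + ((-θ P : ℝ) : EReal)) K := by
    refine hf.add' ?_ ?_
    · exact (continuous_coe_real_ereal.comp_continuousOn hθ.neg).lowerSemicontinuousOn
    · intro P hP
      exact EReal.continuousAt_add (Or.inr (EReal.coe_ne_bot _)) (Or.inr (EReal.coe_ne_top _))
  obtain ⟨P, hPK, hP⟩ := hg.exists_isMinOn ⟨P₀, h₀⟩ hK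
  have hP₀ := hP h₀
  simp only [mem_ofPred_eq, ha] at hP₀
  rw [← EReal.coe_add] at hP₀
  have htop : f P ≠ ⊤ := by
    intro h
    rw [h, EReal.top_add_coe, top_le_iff] at hP₀
    exact EReal.coe_ne_top _ hP₀
  lift f P to ℝ using ⟨htop, hbot P hPK⟩ with p hp
  rw [← EReal.coe_add, EReal.coe_le_coe_iff] at hP₀
  refine ⟨P, hPK, ?_, p - θ P, by linarith, by rw [← hp]; congr 1; ring, ?_⟩
  · by_contra hPO
    have := hO P hPK hPO
    rw [← hp, EReal.coe_lt_coe_iff] at this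
    linarith
  · intro Q hQ
    have h := hP hQ
    simp only [mem_ofPred_eq] at h
    rw [← hp, ← EReal.coe_add] at h
    induction hfQ : f Q with
    | bot => exact absurd hfQ (hbot Q hQ)
    | top => exact le_top
    | coe q =>
      rw [hfQ, ← EReal.coe_add, EReal.coe_le_coe_iff] at h
      rw [EReal.coe_le_coe_iff]
      linarith

theorem LowerSemicontinuousOn.exists_real_le {X : Type*} [TopologicalSpace X] {K : Set X}
    (hK : IsCompact K) {f : X → EReal} (hf : LowerSemicontinuousOn f K)
    (hbot : ∀ P ∈ K, f P ≠ ⊥) : ∃ m : ℝ, ∀ P ∈ K, (m : EReal) ≤ f P := by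
  rcases K.eq_empty_or_nonempty with rfl | hne
  · exact ⟨0, by simp⟩
  obtain ⟨P, hPK, hP⟩ := hf.exists_isMinOn hne hK
  obtain ⟨m, -, hm⟩ := EReal.lt_iff_exists_real_btwn.1 (bot_lt_iff_ne_bot.2 (hbot P hPK))
  exact ⟨m, fun Q hQ => hm.le.trans (hP hQ)⟩

/-! ### One-sided mean value inequalities for lower semicontinuous functions. -/

section MeanValue

variable {E : Type*} [NormedAddCommGroup E] [InnerProductSpace ℝ E] [FiniteDimensional ℝ E]

/-- A one-sided mean value inequality along the vertical segment `{0} × [0, s]`. -/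
theorem le_add_mul_of_touching_vertical {f : E × ℝ → EReal} {O : Set (E × ℝ)} (hO : IsOpen O)
    (hf : LowerSemicontinuousOn f O) (hbot : ∀ P ∈ O, f P ≠ ⊥) {s c a : ℝ} (hs : 0 ≤ s)
    (hseg : ∀ τ ∈ Icc 0 s, ((0 : E), τ) ∈ O)
    (htouch : ∀ P ∈ O, ∀ ψ : E × ℝ → ℝ, ContDiff ℝ ∞ ψ → f P = ψ P →
      (∀ᶠ Q in 𝓝 P, (ψ Q : EReal) ≤ f Q) → fderiv ℝ ψ P (0, 1) ≤ c)
    (ha : f (0, 0) ≤ a) : f (0, s) ≤ ((a + c * s : ℝ) : EReal) := by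
  by_contra! hlt
  lift f (0, 0) to ℝ using ⟨fun h => by simp [h] at ha, hbot _ (hseg 0 ⟨le_rfl, hs⟩)⟩ with a' ha'
  rw [EReal.coe_le_coe_iff] at ha
  obtain ⟨b, hb, hbf⟩ := EReal.lt_iff_exists_real_btwn.1 hlt
  rw [EReal.coe_lt_coe_iff] at hb
  -- The excess b - a - cs is split in two: half for ε, half for raising the slope c to k > c.
  obtain ⟨ε, hε, k, hk, hkb⟩ : ∃ ε > 0, ∃ k > c, a' + k * s + ε ≤ b := by
    refine ⟨(b - a - c * s) / 2, by linarith, c + (b - a - c * s) / 2 / (s + 1), ?_, ?_⟩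
    · have : 0 < (b - a - c * s) / 2 / (s + 1) := by
        apply div_pos <;> linarith
      linarith
    · have : (b - a - c * s) / 2 / (s + 1) * s ≤ (b - a - c * s) / 2 := by
        rw [div_mul_eq_mul_div, div_le_iff₀ (by linarith)]
        nlinarith
      linarith
  obtain ⟨u, v, huo, hvo, hu, hv, huv⟩ := generalized_tube_lemma (s := {(0 : E)})
    (t := Icc 0 s) isCompact_singleton isCompact_Icc hO (by
      rintro ⟨z, τ⟩ ⟨hz, hτ⟩
      rw [mem_singleton_iff] at hz
      subst hz
      exact hseg τ hτ)
  obtain ⟨r, hr, hru⟩ := Metric.nhds_basis_closedBall.mem_iff.1 (huo.mem_nhds (hu rfl))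
  obtain ⟨h, hh₀, hhv⟩ := Metric.nhds_basis_closedBall.mem_iff.1
    (hvo.mem_nhds (hv (left_mem_Icc.2 hs)))
  have hIv : Icc (-h) s ⊆ v := by
    intro τ hτ
    rcases le_total 0 τ with h0 | h0
    · exact hv ⟨h0, hτ.2⟩
    · exact hhv (by
        rw [Metric.mem_closedBall, Real.dist_eq, sub_zero, abs_of_nonpos h0]
        linarith [hτ.1])
  set K : Set (E × ℝ) := Metric.closedBall 0 r ×ˢ Icc (-h) s with hKdef
  have hK : IsCompact K := (isCompact_closedBall _ _).prod isCompact_Icc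
  have hKO : K ⊆ O := (prod_mono hru hIv).trans huv
  obtain ⟨r', hr', hr'f⟩ : ∃ r' > 0, ∀ z : E, ‖z‖ < r' → (b : EReal) < f (z, s) := by
    have h1 := hf (0, s) (hseg s ⟨hs, le_rfl⟩) b hbf
    rw [hO.nhdsWithin_eq (hseg s ⟨hs, le_rfl⟩)] at h1
    have h2 : Tendsto (fun z : E => (z, s)) (𝓝 0) (𝓝 (0, s)) :=
      (Continuous.prodMk_left s).tendsto 0
    obtain ⟨r', hr', H⟩ := Metric.eventually_nhds_iff.1 (h2.eventually h1)
    exact ⟨r', hr', fun z hz => H (by simpa using hz)⟩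
  obtain ⟨m, hm⟩ := (hf.mono hKO).exists_real_le hK (fun P hP => hbot P (hKO hP))
  set r₁ := min r r'
  have hr₁ : 0 < r₁ := lt_min hr hr'
  -- The first bound on A will put θ + a' below m where ‖z‖ ≥ r₁, the second on the bottom face τ =
  -- -h.
  obtain ⟨A, hA0, hA1, hA2⟩ : ∃ A > 0, a' + |k| * (s + h) + ε - m < A * r₁ ^ 2 ∧
      a' + |k| * h - m < ε * (A * h) := by
    have e1 : ∀ᶠ A : ℝ in atTop, a' + |k| * (s + h) + ε - m < A * r₁ ^ 2 :=
      (tendsto_id.atTop_mul_const (by positivity)).eventually_gt_atTop _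
    have e2 : ∀ᶠ A : ℝ in atTop, a' + |k| * h - m < ε * (A * h) :=
      ((tendsto_id.atTop_mul_const hh₀).const_mul_atTop hε).eventually_gt_atTop _
    obtain ⟨A, h1, h2, h3⟩ := ((eventually_gt_atTop 0).and (e1.and e2)).exists
    exact ⟨A, h1, h2, h3⟩
  -- The exponential term costs at most ε for every τ but drops below -εAh at τ = -h, and it only
  -- increases the slope. On the top face near the axis, θ + a' ≤ ks + ε + a' ≤ b < f. Contact
  -- therefore occurs inside the box, at slope greater than c.
  set θ : E × ℝ → ℝ := fun P => k * P.2 + ε * (1 - Real.exp (-A * P.2)) - A * ‖P.1‖ ^ 2 with hθ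
  have hθs : ContDiff ℝ ∞ θ := by
    have : ContDiff ℝ ∞ (fun P : E × ℝ => ‖P.1‖ ^ 2) := contDiff_fst.norm_sq ℝ
    fun_prop
  have hθ0 : θ (0, 0) = 0 := by simp [hθ]
  have h0K : ((0 : E), (0 : ℝ)) ∈ K := ⟨by simp [hr.le], by simp [hs, hh₀.le]⟩
  obtain ⟨P, hPK, hPO, m₁, -, hPm, hQ⟩ := (hf.mono hKO).exists_touching hK
    (fun P hP => hbot P (hKO hP)) hθs.continuous.continuousOn h0K ha'.symm
    (O := Metric.ball 0 r ×ˢ Ioo (-h) s) (by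
      rintro ⟨z, τ⟩ hzK hzO
      obtain ⟨hz, hτ⟩ := hzK
      rw [mem_closedBall_zero_iff] at hz
      rw [hθ0, sub_zero]
      simp only at hz hτ
      have hexp : 0 < Real.exp (-A * τ) := Real.exp_pos _
      have hkτ : k * τ ≤ |k| * (s + h) := by
        refine (le_abs_self _).trans ?_
        rw [abs_mul]
        gcongr
        rw [abs_le]
        constructor <;> linarith [hτ.1, hτ.2]
      by_cases hzr : r₁ ≤ ‖z‖
      · refine lt_of_lt_of_le ?_ (hm _ ⟨by simpa using hz, hτ⟩)
        rw [EReal.coe_lt_coe_iff]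
        have : A * r₁ ^ 2 ≤ A * ‖z‖ ^ 2 := by gcongr
        simp only [hθ]
        nlinarith
      push Not at hzr
      have hzr' : ‖z‖ < r := hzr.trans_le (min_le_left _ _)
      have hAz : 0 ≤ A * ‖z‖ ^ 2 := by positivity
      have hτ' : τ = -h ∨ τ = s := by
        by_contra! hcon
        exact hzO ⟨by simpa using hzr', lt_of_le_of_ne hτ.1 hcon.1.symm,
          lt_of_le_of_ne hτ.2 hcon.2⟩
      rcases hτ' with rfl | rfl
      · refine lt_of_lt_of_le ?_ (hm _ ⟨by simpa using hz, hτ⟩)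
        rw [EReal.coe_lt_coe_iff]
        have h1 := Real.add_one_le_exp (-A * -h)
        have h2 : k * (-h) ≤ |k| * h := by nlinarith [neg_abs_le k]
        simp only [hθ]
        nlinarith
      · refine lt_of_le_of_lt ?_ (hr'f z (hzr.trans_le (min_le_right _ _)))
        rw [EReal.coe_le_coe_iff]
        simp only [hθ]
        nlinarith)
  have hnhds : K ∈ 𝓝 P := by
    refine mem_of_superset ((Metric.isOpen_ball.prod isOpen_Ioo).mem_nhds hPO) ?_
    exact prod_mono Metric.ball_subset_closedBall Ioo_subset_Icc_self
  have hder := htouch P (hKO hPK) (fun Q => θ Q + m₁) (hθs.add contDiff_const) hPm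
    (by filter_upwards [hnhds] with Q hQK using hQ Q hQK)
  have hval : fderiv ℝ (fun Q => θ Q + m₁) P (0, 1) = k + ε * (A * Real.exp (-A * P.2)) := by
    have hd : HasFDerivAt (fun Q => θ Q + m₁) (fderiv ℝ (fun Q => θ Q + m₁) P) P :=
      ((hθs.add contDiff_const).differentiable (by simp) P).hasFDerivAt
    have hl : HasDerivAt (fun τ : ℝ => (P.1, τ)) ((0 : E), (1 : ℝ)) P.2 :=
      (hasDerivAt_const _ _).prodMk (hasDerivAt_id _)
    have h1 := HasFDerivAt.comp_hasDerivAt (x := P.2) (f := fun τ : ℝ => (P.1, τ)) hd hl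
    have h2 : HasDerivAt (fun τ : ℝ => k * τ + ε * (1 - Real.exp (-A * τ)) - A * ‖P.1‖ ^ 2 + m₁)
        (k * 1 + ε * (-(Real.exp (-A * P.2) * (-A * 1)))) P.2 :=
      (((((hasDerivAt_id _).const_mul k).add (((((hasDerivAt_id _).const_mul (-A)).exp).const_sub 1
        ).const_mul ε)).sub_const _).add_const _)
    rw [h1.unique h2]
    ring
  rw [hval] at hder
  have : 0 < ε * (A * Real.exp (-A * P.2)) := by positivity
  linarith

/-- A one-sided mean value inequality along the segment from `(y, t)` to `(y + s • e, t + s)`. -/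
theorem le_add_mul_of_touching {f : E × ℝ → EReal} {O : Set (E × ℝ)} (hO : IsOpen O)
    (hf : LowerSemicontinuousOn f O) (hbot : ∀ P ∈ O, f P ≠ ⊥) {y e : E} {t s c a : ℝ}
    (hs : 0 ≤ s) (hseg : ∀ τ ∈ Icc 0 s, (y + τ • e, t + τ) ∈ O)
    (htouch : ∀ P ∈ O, ∀ ψ : E × ℝ → ℝ, ContDiff ℝ ∞ ψ → f P = ψ P →
      (∀ᶠ Q in 𝓝 P, (ψ Q : EReal) ≤ f Q) → fderiv ℝ ψ P (e, 1) ≤ c)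
    (ha : f (y, t) ≤ a) : f (y + s • e, t + s) ≤ ((a + c * s : ℝ) : EReal) := by
  -- A shear straightens the segment: it carries the vertical direction (0, 1) to (e, 1).
  set Φ : E × ℝ → E × ℝ := fun P => (y + P.1 + P.2 • e, t + P.2)
  set Φ' : E × ℝ → E × ℝ := fun P => (P.1 - y - (P.2 - t) • e, P.2 - t)
  have hΦ : Continuous Φ := by fun_prop
  have hΦ' : ContDiff ℝ ∞ Φ' := by fun_prop
  have hinv : ∀ P, Φ' (Φ P) = P := by
    rintro ⟨z, τ⟩
    simp only [Φ, Φ', Prod.mk.injEq]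
    constructor
    · rw [add_sub_cancel_left]; abel
    · ring
  have hinv' : ∀ P, Φ (Φ' P) = P := by
    rintro ⟨z, τ⟩
    simp only [Φ, Φ', Prod.mk.injEq]
    constructor
    · abel
    · ring
  have key := le_add_mul_of_touching_vertical (f := f ∘ Φ) (O := Φ ⁻¹' O) (c := c) (a := a)
    (hO.preimage hΦ) (hf.comp hΦ.continuousOn (mapsTo_preimage _ _)) (fun P hP => hbot _ hP) hs
    (fun τ hτ => by simpa [Φ] using hseg τ hτ) ?_ (by simpa [Φ] using ha)
  · simpa [Φ] using key
  intro P hP ψ hψ hψP hψle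
  have h1 := htouch (Φ P) hP (ψ ∘ Φ') (hψ.comp hΦ') (by simpa [hinv] using hψP) ?_
  · have hd : fderiv ℝ (ψ ∘ Φ') (Φ P) (e, 1) = fderiv ℝ ψ P (0, 1) := by
      have hl : HasDerivAt (fun σ : ℝ => Φ P + σ • (e, (1 : ℝ))) (e, (1 : ℝ)) 0 := by
        simpa using ((hasDerivAt_id (0 : ℝ)).smul_const (e, (1 : ℝ))).const_add (Φ P)
      have hl' : HasDerivAt (fun σ : ℝ => P + σ • ((0 : E), (1 : ℝ))) ((0 : E), (1 : ℝ)) 0 := by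
        simpa using ((hasDerivAt_id (0 : ℝ)).smul_const ((0 : E), (1 : ℝ))).const_add P
      have d1 := HasFDerivAt.comp_hasDerivAt_of_eq (y := Φ P) (0 : ℝ)
        (((hψ.comp hΦ').differentiable (by simp) (Φ P)).hasFDerivAt) hl (by simp)
      have d2 := HasFDerivAt.comp_hasDerivAt_of_eq (y := P) (0 : ℝ)
        ((hψ.differentiable (by simp) P).hasFDerivAt) hl' (by simp)
      have he : (ψ ∘ Φ') ∘ (fun σ : ℝ => Φ P + σ • (e, (1 : ℝ))) =
          ψ ∘ (fun σ : ℝ => P + σ • ((0 : E), (1 : ℝ))) := by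
        funext σ
        simp only [Function.comp_apply]
        congr 1
        rw [← hinv (P + σ • ((0 : E), (1 : ℝ)))]
        congr 1
        obtain ⟨z, τ⟩ := P
        simp only [Φ, Prod.smul_mk, Prod.mk_add_mk, smul_zero, smul_eq_mul, mul_one, add_zero,
          add_smul, Prod.mk.injEq]
        constructor
        · abel
        · ring
      rw [he] at d1
      exact d1.unique d2
    rwa [hd] at h1
  · have ht : Tendsto Φ' (𝓝 (Φ P)) (𝓝 P) := by
      have := hΦ'.continuous.tendsto (Φ P)
      rwa [hinv] at this
    filter_upwards [ht.eventually hψle] with Q hQ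
    simpa [hinv'] using hQ

end MeanValue

/-! ### Local theory in Euclidean space: propagation, large-time limit, tests from above. -/

/-- The hyperbolic sine as an order isomorphism of the extended reals. -/
noncomputable def sinhEReal : EReal ≃o EReal :=
  Real.sinhOrderIso.withTopCongr.withBotCongr

theorem sinhEReal_coe (r : ℝ) : sinhEReal r = (Real.sinh r : ℝ) := rfl

theorem sinhEReal_bot : sinhEReal ⊥ = ⊥ := rfl

section Local

variable {E : Type*} [NormedAddCommGroup E] [InnerProductSpace ℝ E]

/-- `w_t + G (y, D_y w, w) = 0` on `Ω × (0, ∞)`, tested with functions touching `w` from below. -/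
def IsTouchingSolution (Ω : Set E) (G : E → (E →L[ℝ] ℝ) → ℝ → ℝ) (w : E × ℝ → EReal) : Prop :=
  ∀ y ∈ Ω, ∀ t : ℝ, 0 < t → ∀ ψ : E × ℝ → ℝ, ContDiffAt ℝ 1 ψ (y, t) → w (y, t) = ψ (y, t) →
    (∀ᶠ Q in 𝓝 (y, t), (ψ Q : EReal) ≤ w Q) →
    fderiv ℝ ψ (y, t) (0, 1) +
      G y ((fderiv ℝ ψ (y, t)).comp (ContinuousLinearMap.inl ℝ E ℝ)) (ψ (y, t)) = 0

/-- `G (y, Dv, v) = 0` on `Ω`, tested with functions touching `v` from below. -/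
def IsTouchingSolutionStationary (Ω : Set E) (G : E → (E →L[ℝ] ℝ) → ℝ → ℝ) (v : E → EReal) :
    Prop :=
  ∀ y ∈ Ω, ∀ ψ : E → ℝ, ContDiffAt ℝ 1 ψ y → v y = ψ y →
    (∀ᶠ z in 𝓝 y, (ψ z : EReal) ≤ v z) → G y (fderiv ℝ ψ y) (ψ y) = 0

/-- Linear growth of `G (y, q, r)` in the covector `q`, up to a multiple of `1 + |r|`. -/
def HasLinearGrowth (Ω : Set E) (G : E → (E →L[ℝ] ℝ) → ℝ → ℝ) (a C : ℝ) : Prop :=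
  ∀ y ∈ Ω, ∀ (q : E →L[ℝ] ℝ) (r : ℝ), a * ‖q‖ ≤ G y q r + C * (1 + |r|)

theorem Real.abs_sinh_le_cosh (x : ℝ) : |Real.sinh x| ≤ Real.cosh x := by
  rw [abs_le]
  constructor
  · linarith [Real.cosh_add_sinh x, Real.exp_pos x]
  · linarith [Real.cosh_sub_sinh x, Real.exp_pos (-x)]

variable [FiniteDimensional ℝ E] {Ω : Set E} {G : E → (E →L[ℝ] ℝ) → ℝ → ℝ} {w : E × ℝ → EReal}

/-- Bounds from above propagate at finite speed: `arsinh w` grows at most at the rate `2 C` along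
curves of speed at most `a`. -/
theorem IsTouchingSolution.le_sinh (hw : IsTouchingSolution Ω G w) (hΩ : IsOpen Ω)
    (hconv : Convex ℝ Ω) (hlsc : LowerSemicontinuousOn w (Ω ×ˢ Ioi 0))
    (hbot : ∀ P ∈ Ω ×ˢ Ioi (0 : ℝ), w P ≠ ⊥) {a C : ℝ} (ha : 0 < a) (hC : 0 ≤ C)
    (hG : HasLinearGrowth Ω G a C) {y y' : E} (hy : y ∈ Ω) (hy' : y' ∈ Ω) {t s : ℝ} (ht : 0 < t)
    (hs : 0 ≤ s) (hys : ‖y' - y‖ ≤ a * s) {b : ℝ} (hb : w (y, t) ≤ (Real.sinh b : ℝ)) :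
    w (y', t + s) ≤ (Real.sinh (b + 2 * C * s) : ℝ) := by
  set f : E × ℝ → EReal := sinhEReal.symm ∘ w with hf
  -- When s = 0 the convention 0⁻¹ = 0 gives e = 0, and the speed bound forces y' = y.
  set e : E := s⁻¹ • (y' - y) with he
  have hse : y + s • e = y' := by
    rcases hs.eq_or_lt with rfl | hs0
    · have : y' - y = 0 := by simpa using hys
      simp [sub_eq_zero.1 this]
    · rw [he, smul_inv_smul₀ hs0.ne', add_sub_cancel]
  have hea : ‖e‖ ≤ a := by
    rcases hs.eq_or_lt with rfl | hs0
    · simp [he, ha.le]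
    · rw [he, norm_smul, norm_inv, Real.norm_of_nonneg hs, inv_mul_le_iff₀ hs0]
      linarith
  have key := le_add_mul_of_touching (f := f) (O := Ω ×ˢ Ioi 0) (y := y) (t := t) (e := e) (s := s)
    (c := 2 * C) (a := b) (hΩ.prod isOpen_Ioi)
    (sinhEReal.symm.continuous.comp_lowerSemicontinuousOn hlsc sinhEReal.symm.monotone) ?_ hs ?_ ?_
    ?_
  · rw [hse, hf, Function.comp_apply, OrderIso.symm_apply_le] at key
    exact key
  · intro P hP h
    apply hbot P hP
    rw [← sinhEReal_bot, ← h, hf, Function.comp_apply, OrderIso.apply_symm_apply]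
  · intro τ hτ
    refine ⟨?_, add_pos_of_pos_of_nonneg ht hτ.1⟩
    rcases hs.eq_or_lt with rfl | hs0
    · have : τ = 0 := le_antisymm hτ.2 hτ.1
      simpa [this] using hy
    have := hconv.add_smul_sub_mem hy hy' (t := τ / s)
      ⟨div_nonneg hτ.1 hs, div_le_one_of_le₀ hτ.2 hs⟩
    rwa [div_eq_mul_inv, mul_smul] at this
  · rintro ⟨z, τ⟩ ⟨hz, hτ⟩ ψ hψ hψP hψle
    have hψ1 : ContDiff ℝ 1 ψ := hψ.of_le (by exact_mod_cast le_top)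
    -- If ψ touches arsinh w from below, sinh ∘ ψ touches w from below. Its derivative carries a
    -- factor cosh ψ, which dominates both 1 and |sinh ψ|; dividing by it removes the dependence on
    -- the size of w.
    have h := hw z hz τ hτ (fun Q => Real.sinh (ψ Q)) (hψ1.sinh).contDiffAt ?_ ?_
    · have hd : fderiv ℝ (fun Q => Real.sinh (ψ Q)) (z, τ) =
          Real.cosh (ψ (z, τ)) • fderiv ℝ ψ (z, τ) :=
        ((hψ1.differentiable one_ne_zero _).hasFDerivAt.sinh).fderiv
      rw [hd] at h
      set D := fderiv ℝ ψ (z, τ)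
      have h2 := hG z hz ((Real.cosh (ψ (z, τ)) • D).comp (ContinuousLinearMap.inl ℝ E ℝ))
        (Real.sinh (ψ (z, τ)))
      set Dx := D.comp (ContinuousLinearMap.inl ℝ E ℝ)
      have h3 : D (e, 1) = Dx e + D (0, 1) := by
        simp only [Dx, ContinuousLinearMap.comp_apply, ContinuousLinearMap.inl_apply]
        rw [← map_add]
        simp
      have h4 : Dx e ≤ a * ‖Dx‖ := by
        calc Dx e ≤ ‖Dx e‖ := le_abs_self _
          _ ≤ ‖Dx‖ * ‖e‖ := Dx.le_opNorm e
          _ ≤ ‖Dx‖ * a := by gcongr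
          _ = a * ‖Dx‖ := mul_comm _ _
      have hcosh := Real.one_le_cosh (ψ (z, τ))
      have h5 := Real.abs_sinh_le_cosh (ψ (z, τ))
      rw [ContinuousLinearMap.smul_comp] at h h2
      rw [norm_smul, Real.norm_of_nonneg (by linarith)] at h2
      simp only [_root_.smul_apply, smul_eq_mul] at h
      rw [h3]
      have h6 : Real.cosh (ψ (z, τ)) * (Dx e + D (0, 1)) ≤ Real.cosh (ψ (z, τ)) * (2 * C) := by
        have h7 : Real.cosh (ψ (z, τ)) * Dx e ≤ Real.cosh (ψ (z, τ)) * (a * ‖Dx‖) := by gcongr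
        have h8 : C * (1 + |Real.sinh (ψ (z, τ))|) ≤
            C * (Real.cosh (ψ (z, τ)) + Real.cosh (ψ (z, τ))) := by gcongr
        linarith
      exact le_of_mul_le_mul_left h6 (by linarith)
    · have := congrArg sinhEReal hψP
      rwa [hf, Function.comp_apply, OrderIso.apply_symm_apply, sinhEReal_coe] at this
    · filter_upwards [hψle] with Q hQ
      rwa [hf, Function.comp_apply, OrderIso.le_symm_apply, sinhEReal_coe] at hQ
  · rw [hf, Function.comp_apply, OrderIso.symm_apply_le]
    exact hb

/-- The lower relaxed limit as `t → ∞` solves the stationary equation. -/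
theorem IsTouchingSolution.stationary (hw : IsTouchingSolution Ω G w) (hΩ : IsOpen Ω)
    (hlsc : LowerSemicontinuousOn w (Ω ×ˢ Ioi 0)) (hbot : ∀ P ∈ Ω ×ˢ Ioi (0 : ℝ), w P ≠ ⊥)
    (hG : ContinuousOn (fun p : E × (E →L[ℝ] ℝ) × ℝ => G p.1 p.2.1 p.2.2) (Ω ×ˢ univ))
    {v : E → EReal}
    (hlo : ∀ y ∈ Ω, ∀ a : ℝ, (a : EReal) < v y → ∀ᶠ P in 𝓝 y ×ˢ atTop, (a : EReal) < w P)
    (hup : ∀ y ∈ Ω, ∀ a : ℝ, v y < a → ∃ᶠ P in 𝓝 y ×ˢ atTop, w P < a) :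
    IsTouchingSolutionStationary Ω G v := by
  intro y hy ψ hψ hψy hψle
  -- The quadratic makes the contact at y strict without changing the derivative there.
  set θ : E → ℝ := fun z => ψ z - ‖z - y‖ ^ 2 with hθ
  have hsq : ContDiff ℝ ∞ (fun z : E => ‖z - y‖ ^ 2) := (contDiff_id.sub contDiff_const).norm_sq ℝ
  have hθd : ContDiffAt ℝ 1 θ y := hψ.sub (hsq.of_le (by exact_mod_cast le_top)).contDiffAt
  have hθy : θ y = ψ y := by simp [hθ]
  have hfθ : fderiv ℝ θ y = fderiv ℝ ψ y := by
    have h1 : HasFDerivAt (fun z : E => ‖z - y‖ ^ 2) (0 : E →L[ℝ] ℝ) y := by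
      have := ((hasFDerivAt_id y).sub_const y).norm_sq
      simpa using this
    have := (hψ.differentiableAt one_ne_zero).hasFDerivAt.sub h1
    rw [sub_zero] at this
    exact this.fderiv
  by_contra hne
  set γ := |G y (fderiv ℝ ψ y) (ψ y)| with hγ
  have hγ0 : 0 < γ := abs_pos.2 hne
  -- near `y`, the equation fails by a definite amount
  have hnear : ∀ᶠ p : E × ℝ in 𝓝 (y, ψ y), γ / 2 < |G p.1 (fderiv ℝ θ p.1) p.2| := by
    have h1 : ContinuousAt (fderiv ℝ θ) y := (hθd.fderiv_right (m := 0) (by simp)).continuousAt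
    have h2 : ContinuousAt (fun p : E × (E →L[ℝ] ℝ) × ℝ => G p.1 p.2.1 p.2.2)
        (y, fderiv ℝ θ y, ψ y) :=
      hG.continuousAt ((hΩ.prod isOpen_univ).mem_nhds ⟨hy, mem_univ _⟩)
    have h3 : ContinuousAt (fun p : E × ℝ => (p.1, fderiv ℝ θ p.1, p.2)) (y, ψ y) :=
      continuousAt_fst.prodMk ((h1.comp_of_eq continuousAt_fst rfl).prodMk continuousAt_snd)
    have h4 := (h2.comp_of_eq h3 rfl).abs
    refine h4.eventually (lt_mem_nhds ?_)
    simp only [Function.comp_apply, hfθ, ← hγ]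
    linarith
  obtain ⟨U, hU, W, hW, hUW⟩ := mem_nhds_prod_iff.1 hnear
  obtain ⟨δ, hδ, hδW⟩ := Metric.mem_nhds_iff.1 hW
  have hθc : ∀ᶠ z in 𝓝 y, |θ z - ψ y| < δ / 2 := by
    have := hθd.continuousAt.tendsto
    rw [hθy] at this
    exact (Metric.tendsto_nhds.1 this) (δ / 2) (by linarith)
  obtain ⟨ε, hε, hball⟩ := Metric.nhds_basis_closedBall.mem_iff.1
    (inter_mem (hΩ.mem_nhds hy) (inter_mem hU (inter_mem hθc (inter_mem hψle
      (hψ.eventually (by simp))))))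
  -- a bound from below for large times
  obtain ⟨η, hη, hη1, hη2, hη3⟩ : ∃ η > 0, 3 * η < ε ^ 2 ∧ 3 * η < γ / 5 ∧ 2 * η < δ / 2 := by
    refine ⟨min (ε ^ 2) (min (γ / 5) (δ / 2)) / 4, by positivity, ?_, ?_, ?_⟩
    · have := min_le_left (ε ^ 2) (min (γ / 5) (δ / 2))
      have : 0 < ε ^ 2 := by positivity
      linarith
    · have := (min_le_right (ε ^ 2) (min (γ / 5) (δ / 2))).trans (min_le_left _ _)
      linarith
    · have := (min_le_right (ε ^ 2) (min (γ / 5) (δ / 2))).trans (min_le_right _ _)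
      linarith
  have hlow : ∀ᶠ t in atTop, ∀ z ∈ Metric.closedBall y ε, ((ψ z - η : ℝ) : EReal) < w (z, t) := by
    have hloc : ∀ z ∈ Metric.closedBall y ε, ∃ N ∈ 𝓝[Metric.closedBall y ε] z,
        ∀ᶠ t in atTop, ∀ z' ∈ N, ((ψ z' - η : ℝ) : EReal) < w (z', t) := by
      intro z hz
      obtain ⟨hzΩ, -, -, hzψ, hzd⟩ := hball hz
      have hzd' : ContDiffAt ℝ 1 ψ z := hzd
      have h1 := hlo z hzΩ (ψ z - η / 2) (lt_of_lt_of_le (by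
        rw [EReal.coe_lt_coe_iff]; linarith) hzψ)
      have h2 : ∀ᶠ z' in 𝓝 z, ψ z' < ψ z + η / 2 :=
        hzd'.continuousAt.eventually (gt_mem_nhds (by linarith))
      obtain ⟨pa, hpa, pb, hpb, hab⟩ := eventually_prod_iff.1 h1
      refine ⟨{z' | pa z' ∧ ψ z' < ψ z + η / 2}, mem_nhdsWithin_of_mem_nhds (hpa.and h2), ?_⟩
      filter_upwards [hpb] with t ht z' hz'
      refine lt_of_le_of_lt ?_ (hab hz'.1 ht)
      rw [EReal.coe_le_coe_iff]
      linarith [hz'.2]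
    refine (isCompact_closedBall y ε).induction_on
      (p := fun N => ∀ᶠ t in atTop, ∀ z ∈ N, ((ψ z - η : ℝ) : EReal) < w (z, t))
      (by simp) ?_ ?_ hloc
    · intro s t hst ht
      filter_upwards [ht] with τ hτ z hz using hτ z (hst hz)
    · intro s t hs ht
      filter_upwards [hs, ht] with τ h1 h2 z hz
      exact hz.elim (h1 z) (h2 z)
  obtain ⟨T, hT⟩ := eventually_atTop.1 hlow
  -- a nearly optimal point
  obtain ⟨⟨z₀, t₀⟩, hz₀, hzt⟩ : ∃ P : E × ℝ, w P < ((ψ y + η : ℝ) : EReal) ∧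
      (P.1 ∈ Metric.closedBall y ε ∧ ψ y - η < θ P.1) ∧ max T 0 + 2 < P.2 := by
    have h1 := hup y hy (ψ y + η) (by rw [hψy, EReal.coe_lt_coe_iff]; linarith)
    have h2 : ∀ᶠ z in 𝓝 y, z ∈ Metric.closedBall y ε ∧ ψ y - η < θ z :=
      (eventually_mem_set.2 (Metric.closedBall_mem_nhds y hε)).and
        (hθd.continuousAt.eventually (lt_mem_nhds (by rw [hθy]; linarith)))
    exact (h1.and_eventually (h2.prod_mk (eventually_gt_atTop (max T 0 + 2)))).exists
  obtain ⟨⟨hz₀b, hz₀θ⟩, ht₀⟩ := hzt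
  simp only at hz₀b hz₀θ ht₀
  have ht₀T : T + 1 < t₀ := by linarith [le_max_left T 0]
  have ht₀0 : 1 < t₀ := by linarith [le_max_right T 0]
  set K : Set (E × ℝ) := Metric.closedBall y ε ×ˢ Icc (t₀ - 1) (t₀ + 1) with hKdef
  have hKO : K ⊆ Ω ×ˢ Ioi 0 :=
    prod_mono (fun z hz => (hball hz).1) (fun τ hτ => by
      have := hτ.1
      simp only [mem_Ioi]
      linarith)
  have hK : IsCompact K := (isCompact_closedBall _ _).prod isCompact_Icc
  have h0K : (z₀, t₀) ∈ K := ⟨hz₀b, by simp⟩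
  lift w (z₀, t₀) to ℝ using ⟨hz₀.ne_top, hbot _ (hKO h0K)⟩ with α hα
  rw [EReal.coe_lt_coe_iff] at hz₀
  -- The time penalty localises the contact in |τ - t₀| < 1. Its slope is at most 2γ/5, so the
  -- equation at the contact point gives |G| ≤ 2γ/5, against the lower bound γ/2.
  set Θ : E × ℝ → ℝ := fun P => θ P.1 - γ / 5 * (P.2 - t₀) ^ 2 with hΘ
  have hΘd : ∀ z ∈ Metric.closedBall y ε, ∀ τ, ContDiffAt ℝ 1 Θ (z, τ) := by
    intro z hz τ
    have h1 : ContDiffAt ℝ 1 ψ z := (hball hz).2.2.2.2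
    have h2 : ContDiffAt ℝ 1 θ z := h1.sub (hsq.of_le (by exact_mod_cast le_top)).contDiffAt
    have h3 : ContDiffAt ℝ 1 (fun P : E × ℝ => θ P.1) (z, τ) :=
      ContDiffAt.comp (z, τ) (f := Prod.fst) h2 contDiffAt_fst
    have h4 : ContDiff ℝ 1 (fun P : E × ℝ => γ / 5 * (P.2 - t₀) ^ 2) := by fun_prop
    exact h3.sub h4.contDiffAt
  obtain ⟨⟨z, τ⟩, hPK, hPO, m, hm, hPm, hQ⟩ := (hlsc.mono hKO).exists_touching hK
    (fun P hP => hbot P (hKO hP)) (θ := Θ)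
    (fun P hP => (hΘd P.1 hP.1 P.2).continuousAt.continuousWithinAt) h0K hα.symm
    (O := Metric.ball y ε ×ˢ Ioo (t₀ - 1) (t₀ + 1)) (by
      rintro ⟨z, τ⟩ ⟨hz, hτ⟩ hzO
      simp only at hz hτ
      refine lt_of_le_of_lt ?_ (hT τ (by linarith [hτ.1]) z hz)
      rw [EReal.coe_le_coe_iff]
      have hΘ0 : Θ (z₀, t₀) = θ z₀ := by simp [hΘ]
      rw [hΘ0]
      simp only [hΘ, hθ] at hz₀θ ⊢
      by_cases hzε : ‖z - y‖ = ε
      · rw [hzε]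
        have : 0 ≤ γ / 5 * (τ - t₀) ^ 2 := by positivity
        linarith
      · have hzε' : ‖z - y‖ < ε := lt_of_le_of_ne (by simpa [dist_eq_norm] using hz) hzε
        have hτ' : (τ - t₀) ^ 2 = 1 := by
          by_cases h1 : τ = t₀ - 1
          · rw [h1]; ring
          by_cases h2 : τ = t₀ + 1
          · rw [h2]; ring
          exact absurd ⟨by simpa [dist_eq_norm] using hzε', lt_of_le_of_ne hτ.1 (Ne.symm h1),
            lt_of_le_of_ne hτ.2 h2⟩ hzO
        rw [hτ']
        have : 0 ≤ ‖z - y‖ ^ 2 := by positivity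
        linarith)
  simp only [mem_prod, mem_Ioo] at hPO
  have hzK : z ∈ Metric.closedBall y ε := hPK.1
  have hτK : τ ∈ Icc (t₀ - 1) (t₀ + 1) := hPK.2
  obtain ⟨hzΩ, hzU, hzθ, -, -⟩ := hball hzK
  have hnhds : K ∈ 𝓝 (z, τ) :=
    mem_of_superset ((Metric.isOpen_ball.prod isOpen_Ioo).mem_nhds hPO)
      (prod_mono Metric.ball_subset_closedBall Ioo_subset_Icc_self)
  have heq := hw z hzΩ τ (by linarith [hτK.1]) (fun Q => Θ Q + m)
    ((hΘd z hzK τ).add contDiffAt_const) hPm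
    (by filter_upwards [hnhds] with Q hQK using hQ Q hQK)
  have hdz : DifferentiableAt ℝ θ z := by
    have h1 : ContDiffAt ℝ 1 ψ z := (hball hzK).2.2.2.2
    exact (h1.sub (hsq.of_le (by exact_mod_cast le_top)).contDiffAt).differentiableAt one_ne_zero
  have hD : HasFDerivAt (fun Q => Θ Q + m)
      ((fderiv ℝ θ z).comp (ContinuousLinearMap.fst ℝ E ℝ) -
        (2 * (γ / 5) * (τ - t₀)) • ContinuousLinearMap.snd ℝ E ℝ) (z, τ) := by
    have h1 : HasFDerivAt (fun P : E × ℝ => θ P.1)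
        ((fderiv ℝ θ z).comp (ContinuousLinearMap.fst ℝ E ℝ)) (z, τ) :=
      HasFDerivAt.comp (z, τ) (f := Prod.fst) hdz.hasFDerivAt hasFDerivAt_fst
    have h2 : HasDerivAt (fun σ : ℝ => γ / 5 * (σ - t₀) ^ 2) (2 * (γ / 5) * (τ - t₀)) τ := by
      have := (((hasDerivAt_id τ).sub_const t₀).pow 2).const_mul (γ / 5)
      convert! this using 1
      simp
      ring
    have h3 : HasFDerivAt (fun P : E × ℝ => γ / 5 * (P.2 - t₀) ^ 2)
        ((2 * (γ / 5) * (τ - t₀)) • ContinuousLinearMap.snd ℝ E ℝ) (z, τ) :=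
      HasDerivAt.comp_hasFDerivAt (z, τ) (f := Prod.snd) h2 hasFDerivAt_snd
    exact (h1.sub h3).add_const m
  rw [hD.fderiv] at heq
  have hDx : ((fderiv ℝ θ z).comp (ContinuousLinearMap.fst ℝ E ℝ) -
        (2 * (γ / 5) * (τ - t₀)) • ContinuousLinearMap.snd ℝ E ℝ).comp
        (ContinuousLinearMap.inl ℝ E ℝ) = fderiv ℝ θ z := by
    ext x
    simp
  rw [hDx] at heq
  have hval : |Θ (z, τ) + m - ψ y| < δ := by
    have hup' : Θ (z, τ) + m ≤ θ z + 2 * η := by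
      have h1 : Θ (z₀, t₀) = θ z₀ := by simp [hΘ]
      have h2 : Θ (z, τ) ≤ θ z := by
        simp only [hΘ]
        have : 0 ≤ γ / 5 * (τ - t₀) ^ 2 := by positivity
        linarith
      linarith
    have hlo' : θ z - η ≤ Θ (z, τ) + m := by
      have h1 := hT τ (by linarith [hτK.1]) z hzK
      rw [hPm, EReal.coe_lt_coe_iff] at h1
      have : θ z ≤ ψ z := by
        simp only [hθ]
        have : 0 ≤ ‖z - y‖ ^ 2 := by positivity
        linarith
      linarith
    have h3 := abs_lt.1 (show |θ z - ψ y| < δ / 2 from hzθ)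
    rw [abs_lt]
    constructor <;> linarith
  have hbig : γ / 2 < |G z (fderiv ℝ θ z) (Θ (z, τ) + m)| :=
    hUW (mk_mem_prod hzU (hδW (by rwa [Metric.mem_ball, Real.dist_eq])))
  have hG' : G z (fderiv ℝ θ z) (Θ (z, τ) + m) = 2 * (γ / 5) * (τ - t₀) := by
    simp at heq
    linarith
  rw [hG', abs_mul, abs_of_pos (by positivity)] at hbig
  have h1 : |τ - t₀| ≤ 1 := by
    rw [abs_le]
    constructor <;> linarith [hτK.1, hτK.2]
  nlinarith

/-- For a convex Hamiltonian, a continuous function solving the equation in the sense of test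
functions touching from below is a subsolution for test functions touching from above. -/
theorem IsTouchingSolutionStationary.le_zero_of_touching_above {v : E → ℝ}
    (hv : IsTouchingSolutionStationary Ω G (fun z => (v z : EReal))) (hΩ : IsOpen Ω)
    (hvc : ContinuousOn v Ω)
    (hG : ContinuousOn (fun p : E × (E →L[ℝ] ℝ) × ℝ => G p.1 p.2.1 p.2.2) (Ω ×ˢ univ))
    {a C : ℝ} (ha : 0 < a) (hC : 0 ≤ C) (hgrow : HasLinearGrowth Ω G a C)
    (hconv : ∀ y ∈ Ω, ∀ r, ConvexOn ℝ univ fun q => G y q r) {y : E} (hy : y ∈ Ω) {ψ : E → ℝ}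
    (hψ : DifferentiableAt ℝ ψ y) (hψy : ψ y = v y) (hle : ∀ᶠ z in 𝓝 y, v z ≤ ψ z) :
    G y (fderiv ℝ ψ y) (v y) ≤ 0 := by
  by_contra! hpos
  set S : Set (E →L[ℝ] ℝ) := {q | G y q (v y) ≤ 0} with hS
  have hGy : ∀ q, ContinuousAt (fun p : E × (E →L[ℝ] ℝ) × ℝ => G p.1 p.2.1 p.2.2) (y, q, v y) :=
    fun q => hG.continuousAt ((hΩ.prod isOpen_univ).mem_nhds ⟨hy, mem_univ _⟩)
  have hScl : IsClosed S := by
    refine isClosed_le ?_ continuous_const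
    refine continuous_iff_continuousAt.2 fun q => ?_
    exact ContinuousAt.comp (g := fun p : E × (E →L[ℝ] ℝ) × ℝ => G p.1 p.2.1 p.2.2)
      (f := fun q => (y, q, v y)) (hGy q) (by fun_prop)
  have hSco : Convex ℝ S := by
    simpa using (hconv y hy (v y)).convex_le 0
  obtain ⟨ℓ, c, hℓ, hcℓ⟩ := geometric_hahn_banach_closed_point hSco hScl
    (x := fderiv ℝ ψ y) (by simpa [hS] using hpos)
  -- By the Riesz isomorphism, the separating functional on covectors is evaluation at a vector e.
  obtain ⟨e, he⟩ : ∃ e : E, ∀ q : E →L[ℝ] ℝ, ℓ q = q e := by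
    set L : E →L[ℝ] ℝ :=
      ℓ.comp (InnerProductSpace.toDual ℝ E).toContinuousLinearEquiv.toContinuousLinearMap
    refine ⟨(InnerProductSpace.toDual ℝ E).symm L, fun q => ?_⟩
    obtain ⟨g, rfl⟩ := (InnerProductSpace.toDual ℝ E).surjective q
    rw [InnerProductSpace.toDual_apply_apply, real_inner_comm,
      InnerProductSpace.toDual_symm_apply]
    rfl
  simp only [he] at hℓ hcℓ
  -- near `y`, all covectors in the zero sublevel set lie in the half space
  have hhalf : ∀ᶠ z in 𝓝 y, ∀ q, G z q (v z) ≤ 0 → q e < c := by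
    have hvy : ContinuousAt v y := hvc.continuousAt (hΩ.mem_nhds hy)
    -- Linear growth confines the nearby zero sublevel sets to the ball of radius R, so only a
    -- compact part of the half space c ≤ q(e) has to be excluded.
    set R := C * (2 + |v y|) / a
    have hKc : IsCompact ({q : E →L[ℝ] ℝ | c ≤ q e} ∩ Metric.closedBall 0 R) := by
      refine IsCompact.inter_left (isCompact_closedBall _ _) (isClosed_le continuous_const ?_)
      fun_prop
    have h1 : ∀ᶠ z in 𝓝 y, ∀ q ∈ {q : E →L[ℝ] ℝ | c ≤ q e} ∩ Metric.closedBall 0 R,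
        0 < G z q (v z) := by
      refine hKc.eventually_forall_of_forall_eventually fun q hq => ?_
      have h2 : ContinuousAt (fun p : E × (E →L[ℝ] ℝ) => (p.1, p.2, v p.1)) (y, q) :=
        continuousAt_fst.prodMk (continuousAt_snd.prodMk (hvy.comp_of_eq continuousAt_fst rfl))
      refine ((hGy q).comp_of_eq h2 rfl).eventually (lt_mem_nhds ?_)
      by_contra! hcon
      exact absurd (hℓ q hcon) (not_lt.2 hq.1)
    have h2 : ∀ᶠ z in 𝓝 y, |v z| < |v y| + 1 := hvy.abs.eventually (gt_mem_nhds (by linarith))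
    filter_upwards [h1, h2, hΩ.mem_nhds hy] with z hz1 hz2 hzΩ q hq
    by_contra! hcq
    refine absurd (hz1 q ⟨hcq, ?_⟩) (not_lt.2 hq)
    rw [mem_closedBall_zero_iff, le_div_iff₀ ha]
    have h3 := hgrow z hzΩ q (v z)
    have h4 : C * (1 + |v z|) ≤ C * (2 + |v y|) :=
      mul_le_mul_of_nonneg_left (by linarith) hC
    linarith
  obtain ⟨ρ, hρ, hρb⟩ := Metric.nhds_basis_ball.mem_iff.1
    (inter_mem (hΩ.mem_nhds hy) (inter_mem hhalf hle))
  -- `v` grows at a rate at most `c` along `e`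
  have hgrowth : ∀ᶠ s : ℝ in 𝓝[>] 0, ψ y ≤ ψ (y - s • e) + c * s := by
    have hsmall : ∀ᶠ s : ℝ in 𝓝[>] 0, s * ‖e‖ < ρ := by
      refine eventually_nhdsWithin_of_eventually_nhds ?_
      have : Continuous fun s : ℝ => s * ‖e‖ := by fun_prop
      exact this.continuousAt.eventually (gt_mem_nhds (by simpa using hρ))
    filter_upwards [hsmall, self_mem_nhdsWithin] with s hs hs0
    have hs0' : (0 : ℝ) < s := hs0
    have hmem : ∀ τ ∈ Icc 0 s, y - s • e + τ • e ∈ Metric.ball y ρ := by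
      intro τ hτ
      rw [Metric.mem_ball, dist_eq_norm, show y - s • e + τ • e - y = (τ - s) • e by
        rw [sub_smul]; abel, norm_smul, Real.norm_eq_abs, abs_of_nonpos (by linarith [hτ.2])]
      refine lt_of_le_of_lt ?_ hs
      gcongr
      linarith [hτ.1]
    -- The function v is viewed as constant in time; a test function touching it from below then has
    -- zero time derivative, and its spatial covector lies in {q | q(e) < c}.
    have key := le_add_mul_of_touching (f := fun P : E × ℝ => (v P.1 : EReal))
      (O := Metric.ball y ρ ×ˢ univ) (y := y - s • e) (t := 0) (e := e) (s := s) (c := c)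
      (a := v (y - s • e)) (Metric.isOpen_ball.prod isOpen_univ) ?_ (by simp) hs0'.le
      (fun τ hτ => ⟨hmem τ hτ, mem_univ _⟩) ?_ le_rfl
    · simp only [sub_add_cancel] at key
      rw [EReal.coe_le_coe_iff] at key
      have h0 := hmem 0 ⟨le_rfl, hs0'.le⟩
      rw [zero_smul, add_zero] at h0
      have := (hρb h0).2.2
      simp only [mem_ofPred_eq] at this
      linarith
    · refine ContinuousOn.lowerSemicontinuousOn ?_
      refine continuous_coe_real_ereal.comp_continuousOn ?_
      exact (hvc.mono fun z hz => (hρb hz).1).comp continuousOn_fst fun P hP => hP.1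
    · rintro ⟨z, τ⟩ ⟨hz, -⟩ φ hφ hφz hφle
      have hφ1 : ContDiff ℝ 1 φ := hφ.of_le (by exact_mod_cast le_top)
      simp only [EReal.coe_eq_coe_iff] at hφz
      simp only [EReal.coe_le_coe_iff] at hφle
      have hD : HasFDerivAt φ (fderiv ℝ φ (z, τ)) (z, τ) :=
        (hφ1.differentiable one_ne_zero _).hasFDerivAt
      set D := fderiv ℝ φ (z, τ)
      have hDx : HasFDerivAt (fun z' => φ (z', τ)) (D.comp (ContinuousLinearMap.inl ℝ E ℝ)) z :=
        HasFDerivAt.comp z (f := fun z' => (z', τ)) hD (hasFDerivAt_prodMk_left z τ)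
      have hDt : HasDerivAt (fun σ => φ (z, σ)) (D (0, 1)) τ :=
        HasFDerivAt.comp_hasDerivAt τ (f := fun σ => (z, σ)) hD
          ((hasDerivAt_const _ _).prodMk (hasDerivAt_id _))
      have ht0 : D (0, 1) = 0 := by
        have hmax : IsLocalMax (fun σ => φ (z, σ)) τ := by
          have h1 : Tendsto (fun σ : ℝ => (z, σ)) (𝓝 τ) (𝓝 (z, τ)) :=
            (Continuous.prodMk_right z).tendsto τ
          filter_upwards [h1.eventually hφle] with σ hσ
          simpa [hφz] using hσ
        exact hmax.hasDerivAt_eq_zero hDt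
      have hxle : ∀ᶠ z' in 𝓝 z, ((φ (z', τ) : ℝ) : EReal) ≤ v z' := by
        have h1 : Tendsto (fun z' : E => (z', τ)) (𝓝 z) (𝓝 (z, τ)) :=
          (Continuous.prodMk_left τ).tendsto z
        filter_upwards [h1.eventually hφle] with z' hz'
        simpa using hz'
      have h1 := hv z (hρb hz).1 (fun z' => φ (z', τ))
        (hφ1.comp (contDiff_id.prodMk contDiff_const)).contDiffAt (by simp [hφz]) hxle
      rw [hDx.fderiv, ← hφz] at h1
      have h2 := (hρb hz).2.1 _ h1.le
      have h3 : D (e, 1) = D (e, 0) + D (0, 1) := by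
        rw [← map_add]
        simp
      rw [h3, ht0, add_zero]
      exact h2.le
  have hderiv : HasDerivAt (fun s : ℝ => ψ (y - s • e) + c * s) (-(fderiv ℝ ψ y e) + c) 0 := by
    have h1 : HasDerivAt (fun s : ℝ => y - s • e) (-e) 0 := by
      simpa using ((hasDerivAt_id (0 : ℝ)).smul_const e).const_sub y
    have h2 := HasFDerivAt.comp_hasDerivAt_of_eq (y := y) (0 : ℝ) hψ.hasFDerivAt h1 (by simp)
    have h3 := ((hasDerivAt_id (0 : ℝ)).const_mul c)
    have h4 := h2.add h3
    rw [map_neg, mul_one] at h4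
    exact h4
  have hslope := hderiv.hasDerivWithinAt (s := Ioi 0)
  rw [hasDerivWithinAt_iff_tendsto_slope' (by simp)] at hslope
  -- Comparing ψ(y) with ψ(y - se) + cs as s → 0+ gives Dψ(y)(e) ≤ c, contrary to the separation.
  have hge : 0 ≤ -(fderiv ℝ ψ y e) + c := by
    refine ge_of_tendsto hslope ?_
    filter_upwards [hgrowth, self_mem_nhdsWithin] with s hs hs0
    rw [slope_def_field]
    refine div_nonneg ?_ (by simpa using (le_of_lt hs0))
    simp only [zero_smul, sub_zero, mul_zero, add_zero]
    linarith
  linarith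

end Local

/-! ### From local to global test functions. -/

section Extension

variable {n : ℕ} {M : Type*} [TopologicalSpace M]

/-- A lower semicontinuous function on `M × (0, ∞)`, with `M` compact, has a smooth minorant
depending only on time. -/
theorem exists_contDiffOn_le_spaceTime [CompactSpace M] {u : M × ℝ → EReal}
    (hlsc : LowerSemicontinuousOn u (spaceTime M)) (hbot : ∀ z ∈ spaceTime M, u z ≠ ⊥) :
    ∃ g : ℝ → ℝ, ContDiffOn ℝ ∞ g (Ioi 0) ∧ ∀ z ∈ spaceTime M, (g z.2 : EReal) ≤ u z := by
  have hconv : ∀ s : ℝ, Convex ℝ {r : ℝ | ∀ x : M, (r : EReal) ≤ u (x, Real.exp s)} := by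
    intro s r hr r' hr' α β hα hβ hαβ x
    refine le_trans ?_ (max_le (hr x) (hr' x))
    rw [← EReal.coe_strictMono.monotone.map_max, EReal.coe_le_coe_iff]
    simp only [smul_eq_mul]
    calc α * r + β * r' ≤ α * max r r' + β * max r r' := by
          gcongr
          · exact le_max_left _ _
          · exact le_max_right _ _
      _ = max r r' := by rw [← add_mul, hαβ, one_mul]
  -- With t = exp s, local constant minorants are glued over the whole line by a partition of unity;
  -- the admissible values at each s form a convex set.
  obtain ⟨φ, hφ⟩ := exists_contMDiffMap_forall_mem_convex_of_local_const 𝓘(ℝ, ℝ) (n := ⊤) hconv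
    (fun s => by
      have hsub : (univ : Set M) ×ˢ Icc (Real.exp (s - 1)) (Real.exp (s + 1)) ⊆ spaceTime M :=
        prod_mono subset_rfl fun t ht => (Real.exp_pos _).trans_le ht.1
      obtain ⟨m, hm⟩ := (hlsc.mono hsub).exists_real_le (isCompact_univ.prod isCompact_Icc)
        fun P hP => hbot P (hsub hP)
      refine ⟨m, ?_⟩
      filter_upwards [Icc_mem_nhds (show s - 1 < s by linarith) (show s < s + 1 by linarith)]
        with τ hτ x
      exact hm _ ⟨mem_univ _, Real.exp_le_exp.2 hτ.1, Real.exp_le_exp.2 hτ.2⟩)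
  refine ⟨fun t => φ (Real.log t), ?_, ?_⟩
  · have h1 : ContDiff ℝ ∞ φ := φ.contMDiff.contDiff
    exact h1.comp_contDiffOn (Real.contDiffOn_log.mono fun t ht => ne_of_gt ht)
  · rintro ⟨x, t⟩ ⟨-, ht⟩
    have := hφ (Real.log t) x
    rwa [Real.exp_log ht] at this

variable [ChartedSpace (EuclideanSpace ℝ (Fin n)) M] [IsManifold (𝓡 n) ∞ M]

/-- A `C¹` function touching `u` from below near a point agrees near this point with a `C¹` function
on `M × (0, ∞)` which is everywhere below `u`. -/
theorem exists_isC1SpaceTime_of_touching [CompactSpace M] [T2Space M] {u : M × ℝ → EReal}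
    (hlsc : LowerSemicontinuousOn u (spaceTime M)) (hbot : ∀ z ∈ spaceTime M, u z ≠ ⊥)
    {z : M × ℝ} {φ : M × ℝ → ℝ}
    (hφ : ContMDiffAt ((𝓡 n).prod 𝓘(ℝ, ℝ)) 𝓘(ℝ, ℝ) 1 φ z)
    (hle : ∀ᶠ w in 𝓝 z, (φ w : EReal) ≤ u w) :
    ∃ φ' : M × ℝ → ℝ, IsC1SpaceTime n φ' ∧ φ' =ᶠ[𝓝 z] φ ∧
      ∀ w ∈ spaceTime M, (φ' w : EReal) ≤ u w := by
  obtain ⟨g, hg, hgu⟩ := exists_contDiffOn_le_spaceTime hlsc hbot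
  have hopen : IsOpen (spaceTime M) := isOpen_univ.prod isOpen_Ioi
  have hgM : ∀ w ∈ spaceTime M,
      ContMDiffAt ((𝓡 n).prod 𝓘(ℝ, ℝ)) 𝓘(ℝ, ℝ) 1 (fun w : M × ℝ => g w.2) w := by
    intro w hw
    have h1 : ContDiffAt ℝ 1 g w.2 :=
      ((hg.contDiffAt (isOpen_Ioi.mem_nhds hw.2)).of_le (by exact_mod_cast le_top))
    exact ContMDiffAt.comp w (g := g) (f := Prod.snd) h1.contMDiffAt contMDiffAt_snd
  have : IsManifold ((𝓡 n).prod 𝓘(ℝ, ℝ)) 1 (M × ℝ) :=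
    .of_le (n := ∞) (by exact_mod_cast le_top)
  have hU : {w | (ContMDiffAt ((𝓡 n).prod 𝓘(ℝ, ℝ)) 𝓘(ℝ, ℝ) 1 φ w ∧ (φ w : EReal) ≤ u w)} ∈ 𝓝 z :=
    ((contMDiffAt_iff_contMDiffAt_nhds (by simp)).1 hφ).and hle
  obtain ⟨f, -, hf⟩ := (SmoothBumpFunction.nhds_basis_tsupport
    (I := (𝓡 n).prod 𝓘(ℝ, ℝ)) z).mem_iff.1 hU
  -- On the support of the bump function this is a convex combination of φ and g, both below u;
  -- elsewhere it equals g.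
  refine ⟨fun w => g w.2 + f w * (φ w - g w.2), ?_, ?_, ?_⟩
  · intro w hw
    apply ContMDiffAt.contMDiffWithinAt
    by_cases hws : w ∈ tsupport f
    · have h1 := (hf hws).1
      have h2 : ContMDiffAt ((𝓡 n).prod 𝓘(ℝ, ℝ)) 𝓘(ℝ, ℝ) 1 f w :=
        f.contMDiffAt.of_le (by exact_mod_cast le_top)
      exact (hgM w hw).add (h2.mul (h1.sub (hgM w hw)))
    · refine (hgM w hw).congr_of_eventuallyEq ?_
      filter_upwards [notMem_tsupport_iff_eventuallyEq.1 hws] with w' hw'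
      simp [hw']
  · filter_upwards [f.eventuallyEq_one] with w hw
    simp [hw]
  · intro w hw
    by_cases hws : w ∈ tsupport f
    · refine le_trans ?_ (max_le (hf hws).2 (hgu w hw))
      rw [← EReal.coe_strictMono.monotone.map_max, EReal.coe_le_coe_iff]
      have h0 := f.nonneg (x := w)
      have h1 := f.le_one (x := w)
      calc g w.2 + f w * (φ w - g w.2) = f w * φ w + (1 - f w) * g w.2 := by ring
        _ ≤ f w * max (φ w) (g w.2) + (1 - f w) * max (φ w) (g w.2) := by
          have : 0 ≤ 1 - f w := by linarith
          gcongr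
          · exact le_max_left _ _
          · exact le_max_right _ _
        _ = max (φ w) (g w.2) := by ring
    · have : f w = 0 := image_eq_zero_of_notMem_tsupport hws
      simpa [this] using hgu w hw

end Extension

/-! ### The equation and the Hamiltonian in charts. -/

section Chart

variable {n : ℕ} {M : Type*} [TopologicalSpace M]
  [ChartedSpace (EuclideanSpace ℝ (Fin n)) M] [IsManifold (𝓡 n) ∞ M]

/-- The derivative at `x` of the chart around `x₀`, as a continuous linear map from `T_x M`. -/
noncomputable def chartDeriv (x₀ x : M) : TangentSpace (𝓡 n) x →L[ℝ] EuclideanSpace ℝ (Fin n) :=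
  haveI : IsManifold (𝓡 n) 1 M := .of_le (n := ∞) (by exact_mod_cast le_top)
  (trivializationAt (EuclideanSpace ℝ (Fin n)) (TangentSpace (𝓡 n) (M := M))
    x₀).continuousLinearMapAt ℝ x

/-- The Hamiltonian in the chart around `x₀`. -/
noncomputable def chartHamiltonian (H : CotangentBundle n M → ℝ → ℝ) (x₀ : M)
    (y : EuclideanSpace ℝ (Fin n)) (q : EuclideanSpace ℝ (Fin n) →L[ℝ] ℝ) (r : ℝ) : ℝ :=
  H ⟨(extChartAt (𝓡 n) x₀).symm y, q.comp (chartDeriv x₀ ((extChartAt (𝓡 n) x₀).symm y))⟩ r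

theorem covectorD_comp_extChartAt {x₀ x : M} (hx : x ∈ (extChartAt (𝓡 n) x₀).source)
    {ψ : EuclideanSpace ℝ (Fin n) → ℝ} (hψ : DifferentiableAt ℝ ψ (extChartAt (𝓡 n) x₀ x)) :
    covectorD (fun x' => ψ (extChartAt (𝓡 n) x₀ x')) x =
      (fderiv ℝ ψ (extChartAt (𝓡 n) x₀ x)).comp (chartDeriv x₀ x) := by
  have : IsManifold (𝓡 n) 1 M := .of_le (n := ∞) (by exact_mod_cast le_top)
  have hx' : x ∈ (chartAt (EuclideanSpace ℝ (Fin n)) x₀).source := by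
    rwa [extChartAt_source] at hx
  unfold covectorD chartDeriv
  rw [TangentBundle.continuousLinearMapAt_trivializationAt hx', ← mfderiv_eq_fderiv]
  exact mfderiv_comp (I' := 𝓘(ℝ, EuclideanSpace ℝ (Fin n))) x hψ.mdifferentiableAt
    (mdifferentiableAt_extChartAt hx')

theorem covectorD_eq_fderiv_comp_chartDeriv {x₀ : M} {φ : M → ℝ}
    (hφ : MDifferentiableAt (𝓡 n) 𝓘(ℝ, ℝ) φ x₀) :
    covectorD φ x₀ = (fderiv ℝ (φ ∘ (extChartAt (𝓡 n) x₀).symm) (extChartAt (𝓡 n) x₀ x₀)).comp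
      (chartDeriv x₀ x₀) := by
  have h1 : DifferentiableAt ℝ (φ ∘ (extChartAt (𝓡 n) x₀).symm) (extChartAt (𝓡 n) x₀ x₀) := by
    have := hφ.differentiableWithinAt_writtenInExtChartAt
    rw [modelWithCornersSelf_coe, range_id, differentiableWithinAt_univ] at this
    simpa only [writtenInExtChartAt, extChartAt_model_space_eq_id] using! this
  rw [← covectorD_comp_extChartAt (mem_extChartAt_source x₀) h1]
  unfold covectorD
  refine Filter.EventuallyEq.mfderiv_eq ?_
  filter_upwards [extChartAt_source_mem_nhds (I := 𝓡 n) x₀] with x hx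
  rw [Function.comp_apply, (extChartAt (𝓡 n) x₀).left_inv hx]

/-- A Barron-Jensen solution solves the equation in charts, for local test functions. -/
theorem IsBJSolutionEvolution.isTouchingSolution [CompactSpace M] [T2Space M]
    {H : CotangentBundle n M → ℝ → ℝ} {u : M × ℝ → EReal} (hu : IsBJSolutionEvolution H u)
    (x₀ : M) :
    IsTouchingSolution (extChartAt (𝓡 n) x₀).target (chartHamiltonian H x₀)
      (fun P => u ((extChartAt (𝓡 n) x₀).symm P.1, P.2)) := by
  have : IsManifold (𝓡 n) 1 M := .of_le (n := ∞) (by exact_mod_cast le_top)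
  intro y hy t ht ψ hψ huψ hle
  set χ := extChartAt (𝓡 n) x₀ with hχ
  set x := χ.symm y with hx
  have hxs : x ∈ χ.source := χ.map_target hy
  have hxs' : x ∈ (chartAt (EuclideanSpace ℝ (Fin n)) x₀).source := by
    rwa [hχ, extChartAt_source] at hxs
  have hχx : χ x = y := χ.right_inv hy
  have hz : (x, t) ∈ spaceTime M := ⟨mem_univ _, ht⟩
  set φ : M × ℝ → ℝ := fun w => ψ (χ w.1, w.2) with hφdef
  have hχc : ContMDiffAt (𝓡 n) 𝓘(ℝ, EuclideanSpace ℝ (Fin n)) 1 χ x := contMDiffAt_extChartAt' hxs'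
  have hχ2 : ContMDiffAt ((𝓡 n).prod 𝓘(ℝ, ℝ)) 𝓘(ℝ, EuclideanSpace ℝ (Fin n) × ℝ) 1
      (fun w : M × ℝ => (χ w.1, w.2)) (x, t) :=
    (ContMDiffAt.comp (x, t) (g := χ) (f := Prod.fst) hχc contMDiffAt_fst).prodMk_space
      contMDiffAt_snd
  have hφ : ContMDiffAt ((𝓡 n).prod 𝓘(ℝ, ℝ)) 𝓘(ℝ, ℝ) 1 φ (x, t) := by
    have h1 : ContMDiffAt 𝓘(ℝ, EuclideanSpace ℝ (Fin n) × ℝ) 𝓘(ℝ, ℝ) 1 ψ (χ x, t) := by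
      rw [hχx]
      exact hψ.contMDiffAt
    exact ContMDiffAt.comp (x, t) (g := ψ) (f := fun w : M × ℝ => (χ w.1, w.2)) h1 hχ2
  have hφle : ∀ᶠ w in 𝓝 (x, t), (φ w : EReal) ≤ u w := by
    have h1 : Tendsto (fun w : M × ℝ => (χ w.1, w.2)) (𝓝 (x, t)) (𝓝 (y, t)) := by
      have := hχ2.continuousAt.tendsto
      simpa only [hχx] using this
    have h2 : ∀ᶠ w : M × ℝ in 𝓝 (x, t), w.1 ∈ χ.source :=
      continuousAt_fst.eventually (extChartAt_source_mem_nhds' hxs)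
    filter_upwards [h1.eventually hle, h2] with w hw hws
    simpa [χ.left_inv hws] using hw
  -- Barron–Jensen tests require a global minimum, so the local test function is replaced by a
  -- global minorant with the same germ.
  obtain ⟨φ', hφ'C, hφ'eq, hφ'le⟩ := exists_isC1SpaceTime_of_touching hu.1.lsc hu.1.ne_bot hφ hφle
  have huz : u (x, t) = (ψ (y, t) : ℝ) := huψ
  have hφz : φ' (x, t) = ψ (y, t) := by
    rw [hφ'eq.self_of_nhds, hφdef]
    simp only [hχx]
  have hmin : IsMinOn (fun w => u w - (φ' w : EReal)) (spaceTime M) (x, t) := by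
    intro w hw
    simp only [mem_ofPred_eq]
    rw [huz, hφz, ← EReal.coe_sub, sub_self, EReal.coe_zero]
    exact EReal.sub_nonneg (Or.inr (EReal.coe_ne_top _)) (Or.inr (EReal.coe_ne_bot _)) |>.2
      (hφ'le w hw)
  have hne : u (x, t) ≠ ⊤ := by rw [huz]; exact EReal.coe_ne_top _
  have h0 : evolutionExpr H φ' (x, t) (u (x, t)).toReal = 0 :=
    le_antisymm (hu.1.test φ' hφ'C _ hz hne hmin) (hu.2.test φ' hφ'C _ hz hne hmin)
  have hD : HasFDerivAt ψ (fderiv ℝ ψ (y, t)) (y, t) :=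
    (hψ.differentiableAt one_ne_zero).hasFDerivAt
  have hDx : HasFDerivAt (fun y' => ψ (y', t))
      ((fderiv ℝ ψ (y, t)).comp (ContinuousLinearMap.inl ℝ _ ℝ)) y :=
    HasFDerivAt.comp y (f := fun y' => (y', t)) hD (hasFDerivAt_prodMk_left y t)
  have hDt : HasDerivAt (fun σ => ψ (y, σ)) (fderiv ℝ ψ (y, t) (0, 1)) t :=
    HasFDerivAt.comp_hasDerivAt t (f := fun σ => (y, σ)) hD
      ((hasDerivAt_const _ _).prodMk (hasDerivAt_id _))
  have ht' : deriv (fun s => φ' (x, s)) t = fderiv ℝ ψ (y, t) (0, 1) := by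
    rw [← hDt.deriv]
    refine Filter.EventuallyEq.deriv_eq ?_
    have h1 : Tendsto (fun σ : ℝ => (x, σ)) (𝓝 t) (𝓝 (x, t)) :=
      (Continuous.prodMk_right x).tendsto t
    filter_upwards [h1.eventually hφ'eq] with σ hσ
    rw [hσ, hφdef]
    simp only [hχx]
  have hx' : covectorD (n := n) (fun x' => φ' (x', t)) x =
      ((fderiv ℝ ψ (y, t)).comp (ContinuousLinearMap.inl ℝ _ ℝ)).comp (chartDeriv x₀ x) := by
    rw [← hDx.fderiv, ← hχx, ← covectorD_comp_extChartAt hxs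
      (by rw [← hχ, hχx]; exact hDx.differentiableAt)]
    unfold covectorD
    refine Filter.EventuallyEq.mfderiv_eq ?_
    have h1 : Tendsto (fun x' : M => (x', t)) (𝓝 x) (𝓝 (x, t)) :=
      (Continuous.prodMk_left t).tendsto x
    filter_upwards [h1.eventually hφ'eq] with x' hx'
    rw [hx', hφdef]
  unfold evolutionExpr at h0
  simp only [ht'] at h0
  rw [hx', huz, EReal.toReal_coe] at h0
  exact h0

end Chart

section ChartHamiltonian

variable {n : ℕ} {M : Type*} [TopologicalSpace M]
  [ChartedSpace (EuclideanSpace ℝ (Fin n)) M] [IsManifold (𝓡 n) ∞ M]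

theorem chartHamiltonian_extChartAt_self (H : CotangentBundle n M → ℝ → ℝ) (x : M)
    (q : EuclideanSpace ℝ (Fin n) →L[ℝ] ℝ) (r : ℝ) :
    chartHamiltonian H x (extChartAt (𝓡 n) x x) q r = H ⟨x, q.comp (chartDeriv x x)⟩ r := by
  unfold chartHamiltonian
  rw [extChartAt_to_inv]

/-- This map is the inverse of the cotangent bundle trivialization; the factor coming from the
trivial line bundle is the identity. -/
theorem continuousOn_cotangent_chart (x₀ : M) :
    ContinuousOn (fun p : EuclideanSpace ℝ (Fin n) × (EuclideanSpace ℝ (Fin n) →L[ℝ] ℝ) =>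
      (⟨(extChartAt (𝓡 n) x₀).symm p.1,
        p.2.comp (chartDeriv x₀ ((extChartAt (𝓡 n) x₀).symm p.1))⟩ : CotangentBundle n M))
      ((extChartAt (𝓡 n) x₀).target ×ˢ univ) := by
  have : IsManifold (𝓡 n) 1 M := .of_le (n := ∞) (by exact_mod_cast le_top)
  set e := trivializationAt (EuclideanSpace ℝ (Fin n) →L[ℝ] ℝ)
    (fun x : M => TangentSpace (𝓡 n) x →L[ℝ] Bundle.Trivial M ℝ x) x₀ with he
  have h1 : ContinuousOn
      (fun p : EuclideanSpace ℝ (Fin n) × (EuclideanSpace ℝ (Fin n) →L[ℝ] ℝ) =>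
        e.toOpenPartialHomeomorph.symm ((extChartAt (𝓡 n) x₀).symm p.1, p.2))
      ((extChartAt (𝓡 n) x₀).target ×ˢ univ) := by
    refine e.toOpenPartialHomeomorph.continuousOn_symm.comp ?_ ?_
    · exact ((continuousOn_extChartAt_symm x₀).comp continuousOn_fst fun p hp => hp.1).prodMk
        continuousOn_snd
    · rintro ⟨y, q⟩ ⟨hy, -⟩
      have := (extChartAt (𝓡 n) x₀).map_target hy
      rw [extChartAt_source] at this
      exact ⟨⟨this, mem_univ _⟩, mem_univ _⟩
  refine h1.congr ?_
  rintro ⟨y, q⟩ ⟨hy, -⟩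
  have h2 : e.toOpenPartialHomeomorph.symm ((extChartAt (𝓡 n) x₀).symm y, q) =
    ⟨(extChartAt (𝓡 n) x₀).symm y,
      ((trivializationAt ℝ (Bundle.Trivial M ℝ) x₀).symmL ℝ ((extChartAt (𝓡 n) x₀).symm y)).comp
      (q.comp (chartDeriv x₀ ((extChartAt (𝓡 n) x₀).symm y)))⟩ := rfl
  simp only [h2]
  congr 1
  ext v
  exact (DFunLike.congr_fun (Bundle.Trivial.symmL_trivialization ℝ M ℝ
    ((extChartAt (𝓡 n) x₀).symm y)) _).symm

theorem continuousOn_chartHamiltonian {H : CotangentBundle n M → ℝ → ℝ}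
    (hcont : Continuous (fun q : CotangentBundle n M × ℝ => H q.1 q.2)) (x₀ : M) :
    ContinuousOn (fun p : EuclideanSpace ℝ (Fin n) × (EuclideanSpace ℝ (Fin n) →L[ℝ] ℝ) × ℝ =>
      chartHamiltonian H x₀ p.1 p.2.1 p.2.2) ((extChartAt (𝓡 n) x₀).target ×ˢ univ) := by
  refine hcont.comp_continuousOn (ContinuousOn.prodMk ?_ (by fun_prop))
  exact (continuousOn_cotangent_chart x₀).comp
    (f := fun p : EuclideanSpace ℝ (Fin n) × (EuclideanSpace ℝ (Fin n) →L[ℝ] ℝ) × ℝ =>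
      (p.1, p.2.1)) (by fun_prop) fun p hp => ⟨hp.1, mem_univ _⟩

theorem convexOn_chartHamiltonian {H : CotangentBundle n M → ℝ → ℝ}
    (hconv : IsConvexHamiltonian H) (x₀ : M) (y : EuclideanSpace ℝ (Fin n)) (r : ℝ) :
    ConvexOn ℝ univ fun q => chartHamiltonian H x₀ y q r := by
  set x := (extChartAt (𝓡 n) x₀).symm y
  refine ⟨convex_univ, fun q _ q' _ α β hα hβ hαβ => ?_⟩
  have h := (hconv x r).2 (mem_univ (q.comp (chartDeriv x₀ x)))
    (mem_univ (q'.comp (chartDeriv x₀ x))) hα hβ hαβ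
  simp only [chartHamiltonian]
  rwa [ContinuousLinearMap.add_comp, ContinuousLinearMap.smul_comp, ContinuousLinearMap.smul_comp]

variable [RiemannianBundle (fun x : M => TangentSpace (𝓡 n) x)]
  [IsContMDiffRiemannianBundle (𝓡 n) ∞ (EuclideanSpace ℝ (Fin n))
      (fun x : M => TangentSpace (𝓡 n) x)]

theorem isContinuousRiemannianBundle_tangentSpace :
    IsContinuousRiemannianBundle (EuclideanSpace ℝ (Fin n))
      (fun x : M => TangentSpace (𝓡 n) x) := by
  obtain ⟨g, hg, hgin⟩ := IsContMDiffRiemannianBundle.exists_contMDiff (IB := 𝓡 n) (n := ∞)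
    (F := EuclideanSpace ℝ (Fin n)) (E := fun x : M => TangentSpace (𝓡 n) x)
  exact ⟨g, hg.continuous, hgin⟩

/-- A continuous metric is locally comparable with the Euclidean one. This direction controls chart
distance by Riemannian length. -/
theorem exists_eventually_norm_chartDeriv_le (x₀ : M) : ∃ C : ℝ, 0 < C ∧ ∀ᶠ x in 𝓝 x₀,
    ∀ v : TangentSpace (𝓡 n) x, ‖chartDeriv x₀ x v‖ ≤ C * ‖v‖ := by
  have : IsManifold (𝓡 n) 1 M := .of_le (n := ∞) (by exact_mod_cast le_top)
  have := isContinuousRiemannianBundle_tangentSpace (n := n) (M := M)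
  obtain ⟨C, hC, h⟩ := eventually_norm_trivializationAt_lt (EuclideanSpace ℝ (Fin n))
    (fun x : M => TangentSpace (𝓡 n) x) x₀
  refine ⟨C, hC, ?_⟩
  filter_upwards [h] with x hx v
  have hx' : ‖chartDeriv (n := n) x₀ x‖ ≤ C := hx.le
  exact (ContinuousLinearMap.le_opNorm _ v).trans (by gcongr)

/-- The opposite comparison, dualised: it carries coercivity, stated in the dual Riemannian norm,
over to chart covectors. -/
theorem exists_eventually_norm_le_norm_comp_chartDeriv (x₀ : M) : ∃ C : ℝ, 0 < C ∧
    ∀ᶠ x in 𝓝 x₀, ∀ q : EuclideanSpace ℝ (Fin n) →L[ℝ] ℝ,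
      ‖q‖ ≤ C * ‖q.comp (chartDeriv x₀ x)‖ := by
  have : IsManifold (𝓡 n) 1 M := .of_le (n := ∞) (by exact_mod_cast le_top)
  have := isContinuousRiemannianBundle_tangentSpace (n := n) (M := M)
  obtain ⟨C, hC, h⟩ := eventually_norm_symmL_trivializationAt_lt (EuclideanSpace ℝ (Fin n))
    (fun x : M => TangentSpace (𝓡 n) x) x₀
  refine ⟨C, hC, ?_⟩
  filter_upwards [h, chart_source_mem_nhds (EuclideanSpace ℝ (Fin n)) x₀] with x hx hxs q
  set e := trivializationAt (EuclideanSpace ℝ (Fin n)) (fun x : M => TangentSpace (𝓡 n) x) x₀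
  refine ContinuousLinearMap.opNorm_le_bound _ (by positivity) fun v => ?_
  have h1 : v = chartDeriv x₀ x (e.symmL ℝ x v) :=
    (e.continuousLinearMapAt_symmL (R := ℝ) (b := x) hxs v).symm
  calc ‖q v‖ = ‖(q.comp (chartDeriv x₀ x)) (e.symmL ℝ x v)‖ := by
        conv_lhs => rw [h1]
        rfl
    _ ≤ ‖q.comp (chartDeriv x₀ x)‖ * ‖e.symmL ℝ x v‖ := ContinuousLinearMap.le_opNorm _ _
    _ ≤ ‖q.comp (chartDeriv x₀ x)‖ * (C * ‖v‖) := by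
        gcongr
        exact (ContinuousLinearMap.le_opNorm _ v).trans (by gcongr)
    _ = _ := by ring

/-- A convex coercive Hamiltonian has at least linear growth in the covector, locally uniformly. -/
theorem exists_hasLinearGrowth_chartHamiltonian {H : CotangentBundle n M → ℝ → ℝ}
    (hcont : Continuous (fun q : CotangentBundle n M × ℝ => H q.1 q.2))
    (hcoer : IsCoerciveHamiltonian H) (hconv : IsConvexHamiltonian H)
    (hlip : IsEquiLipschitzHamiltonian H) (x₀ : M) :
    ∃ ρ > 0, ∃ a > 0, ∃ C ≥ 0,
      Metric.ball (extChartAt (𝓡 n) x₀ x₀) ρ ⊆ (extChartAt (𝓡 n) x₀).target ∧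
      HasLinearGrowth (Metric.ball (extChartAt (𝓡 n) x₀ x₀) ρ) (chartHamiltonian H x₀) a C := by
  obtain ⟨Λ, hΛ, hΛH⟩ := hlip
  obtain ⟨κ, hκ, hκe⟩ := exists_eventually_norm_le_norm_comp_chartDeriv (n := n) x₀
  set G := chartHamiltonian H x₀ with hG
  have hGc := continuousOn_chartHamiltonian hcont x₀
  have hsymm : Tendsto (extChartAt (𝓡 n) x₀).symm (𝓝 (extChartAt (𝓡 n) x₀ x₀)) (𝓝 x₀) := by
    have := (continuousAt_extChartAt_symm (I := 𝓡 n) x₀).tendsto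
    rwa [extChartAt_to_inv] at this
  obtain ⟨ρ, hρ, hball⟩ := Metric.nhds_basis_closedBall.mem_iff.1
    (inter_mem (extChartAt_target_mem_nhds (I := 𝓡 n) x₀) (hsymm.eventually hκe))
  set B := Metric.closedBall (extChartAt (𝓡 n) x₀ x₀) ρ
  have hB : IsCompact B := isCompact_closedBall _ _
  have hbound : ∀ K : ℝ, ∃ C, ∀ y ∈ B,
      ∀ q ∈ Metric.closedBall (0 : EuclideanSpace ℝ (Fin n) →L[ℝ] ℝ) K, |G y q 0| ≤ C := by
    intro K
    have h1 : ContinuousOn (fun p : EuclideanSpace ℝ (Fin n) × (EuclideanSpace ℝ (Fin n) →L[ℝ] ℝ) =>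
        G p.1 p.2 0) (B ×ˢ Metric.closedBall 0 K) :=
      hGc.comp (f := fun p : EuclideanSpace ℝ (Fin n) × (EuclideanSpace ℝ (Fin n) →L[ℝ] ℝ) =>
        (p.1, p.2, (0 : ℝ))) (by fun_prop) fun p hp => ⟨(hball hp.1).1, mem_univ _⟩
    obtain ⟨C, hC⟩ := (hB.prod (isCompact_closedBall _ _)).exists_bound_of_continuousOn h1
    exact ⟨C, fun y hy q hq => hC (y, q) ⟨hy, hq⟩⟩
  obtain ⟨C₁, hC₁⟩ := hbound 0
  have hC₁0 : 0 ≤ C₁ := (abs_nonneg _).trans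
    (hC₁ _ (Metric.mem_closedBall_self hρ.le) 0 (by simp))
  -- Since G(y, 0, 0) ≤ C₁, coercivity at level C₁ + 1 forces a rise of at least 1 between the
  -- origin and the sphere of radius κK; convexity continues this slope outwards.
  obtain ⟨K, hK, hKH⟩ := hcoer (C₁ + 1) (by linarith)
  obtain ⟨C₂, hC₂⟩ := hbound (κ * K)
  have hκK : 0 < κ * K := mul_pos hκ hK
  have hC₂0 : 0 ≤ C₂ := (abs_nonneg _).trans
    (hC₂ _ (Metric.mem_closedBall_self hρ.le) 0 (by simp [hκK.le]))
  refine ⟨ρ, hρ, (κ * K)⁻¹, inv_pos.2 hκK, 1 + C₂ + Λ, by linarith,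
    fun y hy => (hball (Metric.ball_subset_closedBall hy)).1, ?_⟩
  intro y hy q r
  have hyB : y ∈ B := Metric.ball_subset_closedBall hy
  have hbig : ∀ q, κ * K ≤ ‖q‖ → C₁ + 1 < G y q 0 := by
    intro q hq
    refine hKH _ _ 0 (by simpa using by linarith) ?_
    have := (hball hyB).2 q
    exact le_of_mul_le_mul_left (hq.trans this) hκ
  have hzero : (κ * K)⁻¹ * ‖q‖ ≤ G y q 0 + (1 + C₂) := by
    rcases lt_or_ge ‖q‖ (κ * K) with hq | hq
    · have h1 := abs_le.1 (hC₂ y hyB q (by simpa using hq.le))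
      have h2 : (κ * K)⁻¹ * ‖q‖ ≤ 1 := by
        rw [inv_mul_le_iff₀ hκK]
        linarith
      linarith
    · have hq0 : 0 < ‖q‖ := hκK.trans_le hq
      -- The factor l brings q back to the sphere of radius κK.
      set l := κ * K / ‖q‖ with hl
      have hl0 : 0 < l := div_pos hκK hq0
      have hl1 : l ≤ 1 := div_le_one_of_le₀ hq hq0.le
      have h1 := (convexOn_chartHamiltonian hconv x₀ y 0).2 (mem_univ 0) (mem_univ q)
        (sub_nonneg.2 hl1) hl0.le (by ring)
      have h2 : C₁ + 1 < G y (l • q) 0 := by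
        apply hbig
        rw [norm_smul, Real.norm_of_nonneg hl0.le, hl, div_mul_cancel₀ _ hq0.ne']
      simp only [smul_zero, zero_add, smul_eq_mul] at h1
      rw [← hG] at h1
      have h3 := (abs_le.1 (hC₁ y hyB 0 (by simp))).2
      have h4 : 1 ≤ l * G y q 0 := by nlinarith
      have h5 : (κ * K)⁻¹ * ‖q‖ = l⁻¹ := by
        rw [hl, inv_div, div_eq_inv_mul]
      have h6 : l⁻¹ ≤ G y q 0 := by
        rw [inv_le_iff_one_le_mul₀ hl0]
        linarith
      linarith
  -- The Lipschitz condition in the unknown passes from r = 0 to general r at cost Λ|r|.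
  have h7 := (abs_le.1 (hΛH ⟨(extChartAt (𝓡 n) x₀).symm y,
    q.comp (chartDeriv x₀ ((extChartAt (𝓡 n) x₀).symm y))⟩ r 0)).1
  rw [sub_zero] at h7
  have h8 : G y q 0 - Λ * |r| ≤ G y q r := by
    simp only [hG, chartHamiltonian]
    linarith
  have h9 := abs_nonneg r
  nlinarith

end ChartHamiltonian

/-! ### Riemannian distance against chart distance. -/

section ChartLipschitz

open MeasureTheory
open scoped ENNReal

variable {n : ℕ} {M : Type*} [MetricSpace M]
  [ChartedSpace (EuclideanSpace ℝ (Fin n)) M] [IsManifold (𝓡 n) ∞ M]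
  [RiemannianBundle (fun x : M => TangentSpace (𝓡 n) x)]
  [IsContMDiffRiemannianBundle (𝓡 n) ∞ (EuclideanSpace ℝ (Fin n))
      (fun x : M => TangentSpace (𝓡 n) x)]
  [IsRiemannianManifold (𝓡 n) M]

/-- Charts of a Riemannian manifold are locally Lipschitz for the Riemannian distance. -/
theorem exists_dist_extChartAt_le (x₀ : M) : ∃ ε > 0, ∃ C : ℝ, 0 < C ∧
    ∀ x ∈ Metric.ball x₀ ε, ∀ y ∈ Metric.ball x₀ ε,
      ‖extChartAt (𝓡 n) x₀ x - extChartAt (𝓡 n) x₀ y‖ ≤ C * dist x y := by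
  have : IsManifold (𝓡 n) 1 M := .of_le (n := ∞) (by exact_mod_cast le_top)
  obtain ⟨C, hC, hCe⟩ := exists_eventually_norm_chartDeriv_le (n := n) x₀
  obtain ⟨ε, hε, hball⟩ := Metric.nhds_basis_ball.mem_iff.1
    (inter_mem (chart_source_mem_nhds (EuclideanSpace ℝ (Fin n)) x₀) hCe)
  -- A curve of length below 2ε/3 starting in the ball of radius ε/3 stays in the ball of radius ε,
  -- where the derivative bound holds.
  refine ⟨ε / 3, by positivity, C, hC, fun x hx y hy => ?_⟩
  have hxy : dist x y < 2 * ε / 3 := by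
    have := dist_triangle_right x y x₀
    rw [Metric.mem_ball] at hx hy
    linarith
  suffices h : ∀ L : ℝ, dist x y < L → L < 2 * ε / 3 →
      ‖extChartAt (𝓡 n) x₀ x - extChartAt (𝓡 n) x₀ y‖ ≤ C * L by
    have hlim : Tendsto (fun L : ℝ => C * L) (𝓝[>] (dist x y)) (𝓝 (C * dist x y)) :=
      ((continuous_const_mul C).tendsto _).mono_left nhdsWithin_le_nhds
    refine ge_of_tendsto hlim ?_
    filter_upwards [Ioo_mem_nhdsGT hxy] with L hL using h L hL.1 hL.2
  intro L hL hLε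
  have hL0 : 0 ≤ L := dist_nonneg.trans hL.le
  have hed : riemannianEDist (𝓡 n) x y < ENNReal.ofReal L := by
    rw [← IsRiemannianManifold.out x y, edist_dist]
    exact (ENNReal.ofReal_lt_ofReal_iff_of_nonneg dist_nonneg).2 hL
  obtain ⟨γ, hγ0, hγ1, hγs, hγL, -⟩ := exists_lt_locally_constant_of_riemannianEDist_lt hed
    zero_lt_one
  have hmem : ∀ t ∈ Icc (0 : ℝ) 1, γ t ∈ Metric.ball x₀ ε := by
    intro t ht
    have h1 : edist x (γ t) ≤ ENNReal.ofReal L := by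
      rw [IsRiemannianManifold.out (I := 𝓡 n) x (γ t)]
      exact (riemannianEDist_le_pathELength hγs.contMDiffOn hγ0 rfl ht.1).trans
        ((pathELength_mono le_rfl ht.2).trans hγL.le)
    rw [edist_dist, ENNReal.ofReal_le_ofReal_iff hL0] at h1
    have := dist_triangle_left (γ t) x₀ x
    rw [Metric.mem_ball] at hx ⊢
    linarith
  set χ := extChartAt (𝓡 n) x₀
  set γ' : ℝ → EuclideanSpace ℝ (Fin n) := χ ∘ γ with hγ'
  have hsm : ContMDiffOn 𝓘(ℝ, ℝ) 𝓘(ℝ, EuclideanSpace ℝ (Fin n)) 1 γ' (Icc 0 1) :=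
    contMDiffOn_extChartAt.comp (t := (chartAt (EuclideanSpace ℝ (Fin n)) x₀).source)
      hγs.contMDiffOn (fun t ht => (hball (hmem t ht)).1)
  have key : ‖γ' 1 - γ' 0‖ₑ ≤ ENNReal.ofReal C * ENNReal.ofReal L := calc
      ‖γ' 1 - γ' 0‖ₑ
    _ ≤ ∫⁻ t in Icc (0 : ℝ) 1, ‖derivWithin γ' (Icc 0 1) t‖ₑ :=
      enorm_sub_le_lintegral_derivWithin_Icc_of_contDiffOn_Icc (contMDiffOn_iff_contDiffOn.1 hsm)
        zero_le_one
    _ ≤ ∫⁻ t in Icc (0 : ℝ) 1, ENNReal.ofReal C *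
          ‖mfderivWithin 𝓘(ℝ, ℝ) (𝓡 n) γ (Icc 0 1) t 1‖ₑ := by
      refine setLIntegral_mono' measurableSet_Icc fun t ht => ?_
      obtain ⟨hts, htC⟩ := hball (hmem t ht)
      have h1 : mfderivWithin 𝓘(ℝ, ℝ) 𝓘(ℝ, EuclideanSpace ℝ (Fin n)) γ' (Icc 0 1) t =
          (mfderiv (𝓡 n) 𝓘(ℝ, EuclideanSpace ℝ (Fin n)) χ (γ t)).comp
            (mfderivWithin 𝓘(ℝ, ℝ) (𝓡 n) γ (Icc 0 1) t) := by
        apply mfderiv_comp_mfderivWithin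
        · exact mdifferentiableAt_extChartAt hts
        · exact (hγs.mdifferentiable one_ne_zero).mdifferentiableOn _ ht
        · rw [uniqueMDiffWithinAt_iff_uniqueDiffWithinAt]
          exact uniqueDiffOn_Icc zero_lt_one _ ht
      have h2 : derivWithin γ' (Icc 0 1) t =
          chartDeriv x₀ (γ t) (mfderivWithin 𝓘(ℝ, ℝ) (𝓡 n) γ (Icc 0 1) t 1) := by
        unfold chartDeriv
        rw [TangentBundle.continuousLinearMapAt_trivializationAt hts, ← fderivWithin_derivWithin,
          ← mfderivWithin_eq_fderivWithin]
        exact congr($h1 1)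
      rw [h2, ← ofReal_norm, ← ofReal_norm, ← ENNReal.ofReal_mul hC.le]
      exact ENNReal.ofReal_le_ofReal (htC _)
    _ = ENNReal.ofReal C * pathELength (𝓡 n) γ 0 1 := by
      rw [lintegral_const_mul' _ _ ENNReal.ofReal_ne_top,
        pathELength_eq_lintegral_mfderivWithin_Icc]
    _ ≤ ENNReal.ofReal C * ENNReal.ofReal L := by gcongr
  rw [← ENNReal.ofReal_mul hC.le, ← ofReal_norm,
    ENNReal.ofReal_le_ofReal_iff (mul_nonneg hC.le hL0), norm_sub_rev] at key
  simpa [hγ', hγ0, hγ1] using key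

end ChartLipschitz

/-! ### The relaxed limit as a lower limit along `𝓝 x ×ˢ atTop`, and clopen arguments. -/

section RelaxedLimit

variable {M : Type*} [PseudoMetricSpace M] {u : M × ℝ → EReal} {x : M}

theorem eventually_lt_of_lt_lowerRelaxedLimit {a : EReal} (ha : a < lowerRelaxedLimit u x) :
    ∀ᶠ P in 𝓝 x ×ˢ atTop, a < u P := by
  obtain ⟨r, hr, hr0⟩ := (((tendsto_lowerRelaxedLimit u x).eventually (lt_mem_nhds ha)).and
    self_mem_nhdsWithin).exists
  filter_upwards [prod_mem_prod (Metric.ball_mem_nhds x hr0) (Ioi_mem_atTop r⁻¹)] with P hP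
  exact hr.trans_le (sInf_le ⟨P.1, P.2, hP.1, hP.2, rfl⟩)

theorem frequently_lt_of_lowerRelaxedLimit_lt {a : EReal} (ha : lowerRelaxedLimit u x < a) :
    ∃ᶠ P in 𝓝 x ×ˢ atTop, u P < a := by
  intro hcon
  refine absurd ha (not_lt.2 (ge_of_tendsto (tendsto_lowerRelaxedLimit u x) ?_))
  obtain ⟨pa, hpa, pb, hpb, hab⟩ := eventually_prod_iff.1 hcon
  obtain ⟨r₀, hr₀, hball⟩ := Metric.mem_nhds_iff.1 hpa
  obtain ⟨T, hT⟩ := eventually_atTop.1 hpb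
  filter_upwards [Ioo_mem_nhdsGT hr₀, tendsto_inv_nhdsGT_zero.eventually_ge_atTop T] with r hr hrT
  refine le_sInf ?_
  rintro _ ⟨y, t, hy, ht, rfl⟩
  exact not_lt.1 (hab (hball (Metric.mem_ball.2 (hy.trans hr.2))) (hT t (hrT.trans ht.le)))

theorem lowerRelaxedLimit_const_time {v : M → EReal} (hv : LowerSemicontinuous v) (x : M) :
    lowerRelaxedLimit (fun z : M × ℝ => v z.1) x = v x := by
  refine le_antisymm ?_ ?_
  · by_contra! h
    exact absurd (eventually_lt_of_lt_lowerRelaxedLimit h)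
      (fun h' => by
        obtain ⟨pa, hpa, pb, hpb, hab⟩ := eventually_prod_iff.1 h'
        obtain ⟨t, ht⟩ := hpb.exists
        exact lt_irrefl _ (hab hpa.self_of_nhds ht))
  · by_contra! h
    obtain ⟨a, ha, hav⟩ := EReal.lt_iff_exists_real_btwn.1 h
    obtain ⟨P, hP, hP'⟩ := ((frequently_lt_of_lowerRelaxedLimit_lt ha).and_eventually
      ((hv x a hav).prod_inl atTop)).exists
    exact lt_asymm hP hP'

end RelaxedLimit

theorem forall_of_locally_constant_pred {X : Type*} [TopologicalSpace X] [PreconnectedSpace X]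
    {P : X → Prop} (hP : ∀ x₀, ∃ N ∈ 𝓝 x₀, ∀ x ∈ N, ∀ y ∈ N, P y → P x) {z : X} (hz : P z) (x : X) :
    P x := by
  have hop : IsOpen {x | P x} := isOpen_iff_mem_nhds.2 fun x hx => by
    obtain ⟨N, hN, h⟩ := hP x
    filter_upwards [hN] with y hy using h y hy x (mem_of_mem_nhds hN) hx
  have hcl : IsOpen {x | P x}ᶜ := isOpen_iff_mem_nhds.2 fun x hx => by
    obtain ⟨N, hN, h⟩ := hP x
    filter_upwards [hN] with y hy hPy using hx (h x (mem_of_mem_nhds hN) y hy hPy)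
  have := IsClopen.eq_univ (s := {x | P x}) ⟨⟨hcl⟩, hop⟩ ⟨z, hz⟩
  exact this.symm.subset (mem_univ x)

theorem EReal.exists_le_sinh {a : EReal} (ha : a ≠ ⊤) : ∃ b : ℝ, a ≤ (Real.sinh b : ℝ) := by
  induction a with
  | bot => exact ⟨0, bot_le⟩
  | top => exact absurd rfl ha
  | coe r => exact ⟨Real.arsinh r, by rw [Real.sinh_arsinh]⟩

/-! ### Global conclusions on the manifold. -/

section Manifold

variable {n : ℕ} {M : Type*} [MetricSpace M] [CompactSpace M]
  [ChartedSpace (EuclideanSpace ℝ (Fin n)) M] [IsManifold (𝓡 n) ∞ M]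
  {H : CotangentBundle n M → ℝ → ℝ} {u : M × ℝ → EReal}

omit [CompactSpace M] [IsManifold (𝓡 n) ∞ M] in
theorem IsBJSolutionEvolution.lowerSemicontinuousOn_chart (hu : IsBJSolutionEvolution H u)
    (x₀ : M) : LowerSemicontinuousOn
      (fun P : EuclideanSpace ℝ (Fin n) × ℝ => u ((extChartAt (𝓡 n) x₀).symm P.1, P.2))
      ((extChartAt (𝓡 n) x₀).target ×ˢ Ioi 0) := by
  refine hu.1.lsc.comp (g := fun P : EuclideanSpace ℝ (Fin n) × ℝ =>
    ((extChartAt (𝓡 n) x₀).symm P.1, P.2)) ?_ fun P hP => ⟨mem_univ _, hP.2⟩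
  exact ((continuousOn_extChartAt_symm x₀).comp continuousOn_fst fun P hP => hP.1).prodMk
    continuousOn_snd

/-- The lower relaxed limit solves the stationary equation in charts. -/
theorem IsBJSolutionEvolution.isTouchingSolutionStationary (hu : IsBJSolutionEvolution H u)
    (hcont : Continuous (fun q : CotangentBundle n M × ℝ => H q.1 q.2)) (x₀ : M) :
    IsTouchingSolutionStationary (extChartAt (𝓡 n) x₀).target (chartHamiltonian H x₀)
      (fun y => lowerRelaxedLimit u ((extChartAt (𝓡 n) x₀).symm y)) := by
  refine (hu.isTouchingSolution x₀).stationary (isOpen_extChartAt_target x₀)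
    (hu.lowerSemicontinuousOn_chart x₀) (fun P hP => hu.1.ne_bot _ ⟨mem_univ _, hP.2⟩)
    (continuousOn_chartHamiltonian hcont x₀) ?_ ?_
  · intro y hy a ha
    have h1 : Tendsto (extChartAt (𝓡 n) x₀).symm (𝓝 y) (𝓝 ((extChartAt (𝓡 n) x₀).symm y)) :=
      (continuousOn_extChartAt_symm x₀).continuousAt
        ((isOpen_extChartAt_target x₀).mem_nhds hy)
    exact (h1.prodMap tendsto_id).eventually (eventually_lt_of_lt_lowerRelaxedLimit ha)
  · intro y hy a ha hcon
    refine frequently_lt_of_lowerRelaxedLimit_lt ha ?_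
    set χ := extChartAt (𝓡 n) x₀
    have hs : χ.symm y ∈ χ.source := χ.map_target hy
    have h1 : Tendsto χ (𝓝 (χ.symm y)) (𝓝 y) := by
      have := (continuousAt_extChartAt' (I := 𝓡 n) hs).tendsto
      rwa [χ.right_inv hy] at this
    have h2 : ∀ᶠ x in 𝓝 (χ.symm y), x ∈ χ.source := extChartAt_source_mem_nhds' hs
    filter_upwards [(h1.prodMap tendsto_id).eventually hcon, h2.prod_inl atTop] with P hP hPs
    simpa only [Prod.map, χ.left_inv hPs, id] using hP

variable [RiemannianBundle (fun x : M => TangentSpace (𝓡 n) x)]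
  [IsContMDiffRiemannianBundle (𝓡 n) ∞ (EuclideanSpace ℝ (Fin n))
      (fun x : M => TangentSpace (𝓡 n) x)]
  [IsRiemannianManifold (𝓡 n) M]

/-- Bounds from above on a solution of the evolution equation propagate at finite speed. -/
theorem IsBJSolutionEvolution.exists_propagation (hu : IsBJSolutionEvolution H u)
    (hcont : Continuous (fun q : CotangentBundle n M × ℝ => H q.1 q.2))
    (hcoer : IsCoerciveHamiltonian H) (hconv : IsConvexHamiltonian H)
    (hlip : IsEquiLipschitzHamiltonian H) (x₀ : M) :
    ∃ N ∈ 𝓝 x₀, ∃ κ > 0, ∃ D ≥ 0, ∀ x ∈ N, ∀ y ∈ N, ∀ t s : ℝ, 0 < t → κ * dist x y ≤ s →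
      ∀ b : ℝ, u (y, t) ≤ (Real.sinh b : ℝ) → u (x, t + s) ≤ (Real.sinh (b + D * s) : ℝ) := by
  obtain ⟨ρ, hρ, a, ha, C, hC, hsub, hgrow⟩ :=
    exists_hasLinearGrowth_chartHamiltonian hcont hcoer hconv hlip x₀
  obtain ⟨ε, hε, L, hL, hdist⟩ := exists_dist_extChartAt_le (n := n) x₀
  set χ := extChartAt (𝓡 n) x₀
  -- The chart is L-Lipschitz and bounds travel at speed a, so a time L/a times the distance
  -- suffices.
  refine ⟨Metric.ball x₀ ε ∩ (χ.source ∩ χ ⁻¹' Metric.ball (χ x₀) ρ), ?_, L / a, by positivity,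
    2 * C, by positivity, ?_⟩
  · refine inter_mem (Metric.ball_mem_nhds _ hε) (inter_mem (extChartAt_source_mem_nhds x₀) ?_)
    exact (continuousAt_extChartAt x₀).preimage_mem_nhds (Metric.ball_mem_nhds _ hρ)
  rintro x ⟨hxε, hxs, hxρ⟩ y ⟨hyε, hys, hyρ⟩ t s ht hs b hb
  have hs0 : 0 ≤ s := le_trans (by positivity) hs
  have h1 : ‖χ x - χ y‖ ≤ a * s := by
    refine (hdist x hxε y hyε).trans ?_
    calc L * dist x y = a * (L / a * dist x y) := by field_simp
      _ ≤ a * s := by gcongr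
  have h2 : IsTouchingSolution (Metric.ball (χ x₀) ρ) (chartHamiltonian H x₀)
      (fun P => u (χ.symm P.1, P.2)) :=
    fun z hz => hu.isTouchingSolution x₀ z (hsub hz)
  have h3 := h2.le_sinh Metric.isOpen_ball (convex_ball _ _)
    ((hu.lowerSemicontinuousOn_chart x₀).mono (prod_mono hsub subset_rfl))
    (fun P hP => hu.1.ne_bot _ ⟨mem_univ _, hP.2⟩) ha hC hgrow hyρ hxρ ht hs0 h1 (b := b)
    (by simpa only [χ.left_inv hys] using hb)
  simpa only [χ.left_inv hxs] using h3

/-- Propagation from almost optimal points (y', t) with t → ∞. The wait is essentially the shortest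
allowed, κ d(x, y), which yields the constant Dκ. -/
theorem IsBJSolutionEvolution.exists_lowerRelaxedLimit_le (hu : IsBJSolutionEvolution H u)
    (hcont : Continuous (fun q : CotangentBundle n M × ℝ => H q.1 q.2))
    (hcoer : IsCoerciveHamiltonian H) (hconv : IsConvexHamiltonian H)
    (hlip : IsEquiLipschitzHamiltonian H) (x₀ : M) :
    ∃ N ∈ 𝓝 x₀, ∃ K : ℝ≥0, ∀ x ∈ N, ∀ y ∈ N, ∀ b : ℝ,
      lowerRelaxedLimit u y ≤ (Real.sinh b : ℝ) →
        lowerRelaxedLimit u x ≤ (Real.sinh (b + K * dist x y) : ℝ) := by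
  obtain ⟨N, hN, κ, hκ, D, hD, h⟩ := hu.exists_propagation hcont hcoer hconv hlip x₀
  -- The interior keeps the points y' near y inside N; the slack η keeps κ d(x, y') below the
  -- waiting time.
  refine ⟨interior N, interior_mem_nhds.2 hN, (D * κ).toNNReal, fun x hx y hy b hb => ?_⟩
  suffices hη : ∀ η : ℝ, 0 < η → lowerRelaxedLimit u x ≤
      (Real.sinh (b + η + D * (κ * dist x y + η)) : ℝ) by
    have hc : Continuous fun η : ℝ =>
        ((Real.sinh (b + η + D * (κ * dist x y + η)) : ℝ) : EReal) :=
      continuous_coe_real_ereal.comp (by fun_prop)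
    have hlim := (hc.tendsto 0).mono_left (nhdsWithin_le_nhds (s := Ioi 0))
    simp only [add_zero] at hlim
    rw [Real.coe_toNNReal _ (by positivity), mul_assoc]
    refine ge_of_tendsto hlim ?_
    filter_upwards [self_mem_nhdsWithin] with η hη0 using hη η hη0
  intro η hη
  set s := κ * dist x y + η
  by_contra! hlt
  have h1 : lowerRelaxedLimit u y < (Real.sinh (b + η) : ℝ) :=
    hb.trans_lt (EReal.coe_lt_coe_iff.2 (Real.sinh_lt_sinh.2 (by linarith)))
  have h2 : Tendsto (fun P : M × ℝ => (x, P.2 + s)) (𝓝 y ×ˢ atTop) (𝓝 x ×ˢ atTop) :=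
    tendsto_const_nhds.prodMk (tendsto_atTop_add_const_right _ _ tendsto_snd)
  have h3 : ∀ᶠ y' in 𝓝 y, y' ∈ N ∧ κ * dist x y' < s := by
    refine (eventually_mem_set.2 (mem_interior_iff_mem_nhds.1 hy)).and ?_
    have : Continuous fun y' => κ * dist x y' := by fun_prop
    exact this.continuousAt.eventually (gt_mem_nhds (by simp [s, hη]))
  obtain ⟨⟨y', t⟩, hu1, hu2, ⟨hy'N, hy's⟩, ht⟩ :=
    ((frequently_lt_of_lowerRelaxedLimit_lt h1).and_eventually
      ((h2.eventually (eventually_lt_of_lt_lowerRelaxedLimit hlt)).and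
        (h3.prod_mk (eventually_gt_atTop 0)))).exists
  exact absurd (h x (interior_subset hx) y' hy'N t s ht hy's.le (b + η) hu1.le) (not_le.2 hu2)

/-- Both ⊥ and "not ⊤" spread across the neighbourhoods of the local estimate, so each holds on a
clopen set. -/
theorem IsBJSolutionEvolution.lowerRelaxedLimit_finite [ConnectedSpace M]
    (hu : IsBJSolutionEvolution H u)
    (hcont : Continuous (fun q : CotangentBundle n M × ℝ => H q.1 q.2))
    (hcoer : IsCoerciveHamiltonian H) (hconv : IsConvexHamiltonian H)
    (hlip : IsEquiLipschitzHamiltonian H) {z : M} (hbot : lowerRelaxedLimit u z ≠ ⊥)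
    (htop : lowerRelaxedLimit u z ≠ ⊤) (x : M) :
    lowerRelaxedLimit u x ≠ ⊥ ∧ lowerRelaxedLimit u x ≠ ⊤ := by
  constructor
  · intro hx
    refine hbot (forall_of_locally_constant_pred (P := fun x => lowerRelaxedLimit u x = ⊥)
      (fun x₀ => ?_) hx z)
    obtain ⟨N, hN, K, h⟩ := hu.exists_lowerRelaxedLimit_le hcont hcoer hconv hlip x₀
    refine ⟨N, hN, fun x hx y hy hyb => EReal.eq_bot_iff_forall_lt _ |>.2 fun r => ?_⟩
    -- At a point with value ⊥ every b is admissible; this one makes the bound at x equal to r - 1.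
    have h1 := h x hx y hy (Real.arsinh (r - 1) - K * dist x y) (by rw [hyb]; exact bot_le)
    rw [sub_add_cancel, Real.sinh_arsinh] at h1
    exact h1.trans_lt (EReal.coe_lt_coe_iff.2 (by linarith))
  · refine forall_of_locally_constant_pred (P := fun x => lowerRelaxedLimit u x ≠ ⊤)
      (fun x₀ => ?_) htop x
    obtain ⟨N, hN, K, h⟩ := hu.exists_lowerRelaxedLimit_le hcont hcoer hconv hlip x₀
    refine ⟨N, hN, fun x hx y hy hyt => ?_⟩
    obtain ⟨b, hb⟩ := EReal.exists_le_sinh hyt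
    exact ((h x hx y hy b hb).trans_lt (EReal.coe_lt_top _)).ne

/-- The local estimate makes arsinh w locally Lipschitz; sinh preserves this, and compactness makes
it global. -/
theorem IsBJSolutionEvolution.exists_lipschitzWith (hu : IsBJSolutionEvolution H u)
    (hcont : Continuous (fun q : CotangentBundle n M × ℝ => H q.1 q.2))
    (hcoer : IsCoerciveHamiltonian H) (hconv : IsConvexHamiltonian H)
    (hlip : IsEquiLipschitzHamiltonian H) {w : M → ℝ}
    (hw : ∀ x, lowerRelaxedLimit u x = (w x : EReal)) : ∃ C : ℝ≥0, LipschitzWith C w := by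
  have h1 : LocallyLipschitz fun x => Real.arsinh (w x) := by
    intro x₀
    obtain ⟨N, hN, K, h⟩ := hu.exists_lowerRelaxedLimit_le hcont hcoer hconv hlip x₀
    refine ⟨K, N, hN, LipschitzOnWith.of_le_add_mul K fun x hx y hy => ?_⟩
    have h2 := h x hx y hy (Real.arsinh (w y)) (by rw [hw, Real.sinh_arsinh])
    rw [hw, EReal.coe_le_coe_iff, ← Real.arsinh_le_arsinh, Real.arsinh_sinh] at h2
    exact h2
  have h2 : LocallyLipschitz w := by
    have := (Real.contDiff_sinh (n := 1)).locallyLipschitz.comp h1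
    simpa [Function.comp_def] using this
  obtain ⟨C, hC⟩ := (h2.locallyLipschitzOn (s := univ)).exists_lipschitzOnWith_of_compact
    isCompact_univ
  exact ⟨C, lipschitzOnWith_univ.1 hC⟩

omit [IsRiemannianManifold (𝓡 n) M] in
/-- A continuous lower relaxed limit is a viscosity solution of the stationary equation. -/
theorem IsBJSolutionEvolution.isViscositySolution (hu : IsBJSolutionEvolution H u)
    (hcont : Continuous (fun q : CotangentBundle n M × ℝ => H q.1 q.2))
    (hcoer : IsCoerciveHamiltonian H) (hconv : IsConvexHamiltonian H)
    (hlip : IsEquiLipschitzHamiltonian H) {w : M → ℝ}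
    (hw : ∀ x, lowerRelaxedLimit u x = (w x : EReal)) (hwc : Continuous w) :
    IsViscositySolution H w := by
  have hst : ∀ x : M, IsTouchingSolutionStationary (extChartAt (𝓡 n) x).target
      (chartHamiltonian H x) (fun y => (w ((extChartAt (𝓡 n) x).symm y) : EReal)) := by
    intro x
    have := hu.isTouchingSolutionStationary hcont x
    simpa only [hw] using this
  have hφC : ∀ (φ : M → ℝ), ContMDiff (𝓡 n) 𝓘(ℝ, ℝ) 1 φ → ∀ (x : M) (c : ℝ),
      ContDiffAt ℝ 1 (fun y => φ ((extChartAt (𝓡 n) x).symm y) + c) (extChartAt (𝓡 n) x x) ∧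
      chartHamiltonian H x (extChartAt (𝓡 n) x x)
        (fderiv ℝ (fun y => φ ((extChartAt (𝓡 n) x).symm y) + c) (extChartAt (𝓡 n) x x)) (w x) =
          stationaryExpr H φ x (w x) := by
    intro φ hφ x c
    constructor
    · refine ContDiffAt.add ?_ contDiffAt_const
      have h1 : ContMDiffAt (𝓡 n) 𝓘(ℝ, ℝ) 1 φ
        ((extChartAt (𝓡 n) x).symm (extChartAt (𝓡 n) x x)) := hφ.contMDiffAt
      have h2 := (contMDiffOn_extChartAt_symm (I := 𝓡 n) (n := 1) x).contMDiffAt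
        (extChartAt_target_mem_nhds x)
      exact (h1.comp _ h2).contDiffAt
    · rw [chartHamiltonian_extChartAt_self, fderiv_add_const, stationaryExpr,
        covectorD_eq_fderiv_comp_chartDeriv (hφ.mdifferentiableAt one_ne_zero)]
      rfl
  refine ⟨⟨hwc.upperSemicontinuous, fun φ hφ x hx => ?_⟩,
    ⟨hwc.lowerSemicontinuous, fun φ hφ x hx => ?_⟩⟩
  -- Adding w(x) - φ(x) turns the extremum of w - φ into contact at x.
  · obtain ⟨hC1, heq⟩ := hφC φ hφ x (w x - φ x)
    obtain ⟨ρ, hρ, a, ha, C, hC, hsub, hgrow⟩ :=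
      exists_hasLinearGrowth_chartHamiltonian hcont hcoer hconv hlip x
    have hv : IsTouchingSolutionStationary (Metric.ball (extChartAt (𝓡 n) x x) ρ)
        (chartHamiltonian H x) (fun y => (w ((extChartAt (𝓡 n) x).symm y) : EReal)) :=
      fun y hy => hst x y (hsub hy)
    have h := hv.le_zero_of_touching_above Metric.isOpen_ball
      (hwc.comp_continuousOn ((continuousOn_extChartAt_symm x).mono hsub))
      ((continuousOn_chartHamiltonian hcont x).mono (prod_mono hsub subset_rfl)) ha hC hgrow
      (fun y _ r => convexOn_chartHamiltonian hconv x y r) (Metric.mem_ball_self hρ)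
      (hC1.differentiableAt one_ne_zero) (by simp only [extChartAt_to_inv]; ring)
      (Eventually.of_forall fun y => by
        have := hx (mem_univ ((extChartAt (𝓡 n) x).symm y))
        simp only [mem_ofPred_eq] at this
        linarith)
    simp only [extChartAt_to_inv] at h
    rwa [heq] at h
  · obtain ⟨hC1, heq⟩ := hφC φ hφ x (w x - φ x)
    have h := hst x (extChartAt (𝓡 n) x x) (mem_extChartAt_target x) _ hC1
      (by simp only [extChartAt_to_inv]; congr 1; ring)
      (Eventually.of_forall fun y => by
        have := hx (mem_univ ((extChartAt (𝓡 n) x).symm y))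
        simp only [mem_ofPred_eq] at this
        rw [EReal.coe_le_coe_iff]
        linarith)
    simp only [extChartAt_to_inv, add_sub_cancel] at h
    rw [heq] at h
    exact h.ge

end Manifold

/-- A Barron-Jensen solution of the stationary equation is a time independent Barron-Jensen solution
of the evolution equation. -/
theorem IsBJSolutionStationary.evolution {n : ℕ} {M : Type*} [TopologicalSpace M]
    [ChartedSpace (EuclideanSpace ℝ (Fin n)) M] {H : CotangentBundle n M → ℝ → ℝ} {v : M → EReal}
    (hv : IsBJSolutionStationary H v) : IsBJSolutionEvolution H (fun z : M × ℝ => v z.1) := by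
  have hlsc : LowerSemicontinuousOn (fun z : M × ℝ => v z.1) (spaceTime M) :=
    (hv.1.lsc.comp continuous_fst).lowerSemicontinuousOn _
  have hred : ∀ φ : M × ℝ → ℝ, IsC1SpaceTime n φ → ∀ z ∈ spaceTime M, v z.1 ≠ ⊤ →
      IsMinOn (fun w : M × ℝ => v w.1 - (φ w : EReal)) (spaceTime M) z →
      ContMDiff (𝓡 n) 𝓘(ℝ, ℝ) 1 (fun y => φ (y, z.2)) ∧
      IsMinOn (fun y => v y - ((φ (y, z.2) : ℝ) : EReal)) univ z.1 ∧
      evolutionExpr H φ z (v z.1).toReal =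
        stationaryExpr H (fun y => φ (y, z.2)) z.1 (v z.1).toReal := by
    rintro φ hφ ⟨x, t⟩ hz htop hmin
    simp only at htop
    refine ⟨?_, fun y _ => hmin (show (y, t) ∈ spaceTime M from ⟨mem_univ _, hz.2⟩), ?_⟩
    · intro y
      have h1 : ContMDiffAt ((𝓡 n).prod 𝓘(ℝ, ℝ)) 𝓘(ℝ, ℝ) 1 φ (y, t) :=
        hφ.contMDiffAt ((isOpen_univ.prod isOpen_Ioi).mem_nhds ⟨mem_univ _, hz.2⟩)
      exact ContMDiffAt.comp y (g := φ) (f := fun y => (y, t)) h1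
        (contMDiffAt_id.prodMk contMDiffAt_const)
    -- As v does not depend on time, a minimum of v - φ makes φ(x, ·) maximal at t, so the time
    -- derivative vanishes.
    · have hmax : IsLocalMax (fun s => φ (x, s)) t := by
        filter_upwards [Ioi_mem_nhds hz.2] with s hs
        have h1 := hmin (show (x, s) ∈ spaceTime M from ⟨mem_univ _, hs⟩)
        simp only [mem_ofPred_eq] at h1
        lift v x to ℝ using ⟨htop, hv.1.ne_bot x⟩ with r
        rw [← EReal.coe_sub, ← EReal.coe_sub, EReal.coe_le_coe_iff] at h1
        linarith
      simp only [evolutionExpr, stationaryExpr, hmax.deriv_eq_zero, zero_add]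
  refine ⟨⟨fun z _ => hv.1.ne_bot _, hlsc, fun φ hφ z hz htop hmin => ?_⟩,
    ⟨fun z _ => hv.1.ne_bot _, hlsc, fun φ hφ z hz htop hmin => ?_⟩⟩
  · obtain ⟨h1, h2, h3⟩ := hred φ hφ z hz htop hmin
    rw [h3]
    exact hv.1.test _ h1 _ htop h2
  · obtain ⟨h1, h2, h3⟩ := hred φ hφ z hz htop hmin
    rw [h3]
    exact hv.2.test _ h1 _ htop h2

theorem theorem6p1 {n : ℕ} {M : Type*} [MetricSpace M] [CompactSpace M] [ConnectedSpace M]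
    [ChartedSpace (EuclideanSpace ℝ (Fin n)) M] [IsManifold (𝓡 n) ∞ M]
    [RiemannianBundle (fun x : M => TangentSpace (𝓡 n) x)]
    [IsContMDiffRiemannianBundle (𝓡 n) ∞ (EuclideanSpace ℝ (Fin n))
      (fun x : M => TangentSpace (𝓡 n) x)]
    [IsRiemannianManifold (𝓡 n) M]
    (H : CotangentBundle n M → ℝ → ℝ)
    (hcont : Continuous (fun q : CotangentBundle n M × ℝ => H q.1 q.2))
    (hcoer : IsCoerciveHamiltonian H)
    (hconv : IsConvexHamiltonian H)
    (hlip : IsEquiLipschitzHamiltonian H) :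
    (∀ u : M × ℝ → EReal, IsBJSolutionEvolution H u →
      (∃ z : M, lowerRelaxedLimit u z ≠ ⊥ ∧ lowerRelaxedLimit u z ≠ ⊤) →
      ∃ w : M → ℝ, (∀ x, lowerRelaxedLimit u x = (w x : EReal)) ∧
        (∃ C : ℝ≥0, LipschitzWith C w) ∧ IsViscositySolution H w) ∧
    (∀ v : M → EReal, IsBJSolutionStationary H v → (∃ z : M, v z ≠ ⊤) →
      ∃ w : M → ℝ, (∀ x, v x = (w x : EReal)) ∧ ∃ C : ℝ≥0, LipschitzWith C w) := by
  have main : ∀ u : M × ℝ → EReal, IsBJSolutionEvolution H u →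
      (∃ z : M, lowerRelaxedLimit u z ≠ ⊥ ∧ lowerRelaxedLimit u z ≠ ⊤) →
      ∃ w : M → ℝ, (∀ x, lowerRelaxedLimit u x = (w x : EReal)) ∧
        (∃ C : ℝ≥0, LipschitzWith C w) ∧ IsViscositySolution H w := by
    rintro u hu ⟨z, hbot, htop⟩
    have hfin := hu.lowerRelaxedLimit_finite hcont hcoer hconv hlip hbot htop
    have hw : ∀ x, lowerRelaxedLimit u x = ((lowerRelaxedLimit u x).toReal : EReal) :=
      fun x => (EReal.coe_toReal (hfin x).2 (hfin x).1).symm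
    obtain ⟨C, hC⟩ := hu.exists_lipschitzWith hcont hcoer hconv hlip hw
    exact ⟨_, hw, ⟨C, hC⟩, hu.isViscositySolution hcont hcoer hconv hlip hw hC.continuous⟩
  refine ⟨main, fun v hv hz => ?_⟩
  obtain ⟨z, hz⟩ := hz
  have hlim := lowerRelaxedLimit_const_time hv.1.lsc
  obtain ⟨w, hw, hC, -⟩ := main _ hv.evolution ⟨z, by rw [hlim]; exact ⟨hv.1.ne_bot z, hz⟩⟩
  exact ⟨w, fun x => by rw [← hlim x, hw], hC⟩
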